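/- There are absolute constants $\gamma_1>0$ and $C>0$ such that the following holds. Let $F$ be a field and let $A,B\subseteq F$ be finite sets with $0\notin B$, $|A|\le |B|^{2}$ and $|B|\le |A|^{161}$. Let $P\subseteq F\times F$ be a set of points, each of which lies on the intersection of a line $y=ax$ with $a\in A$ and a line $y=b$ with $b\in B$. Let $L(P)$ be the set of lines determined by pairs of distinct points of $P$, and let $$T=I_3(P,L(P))=\left|\left\{(p_1,p_2,p_3,l)\in P^3\times L(P): p_1,p_2,p_3\in l\right\}\right|.$$ Put $\lambda=\gamma_1T^{65}/(|A|^{130}|B|^{194})$ (with $\lambda=0$ if $A$ or $B$ is empty), and suppose that $P$ is a $(2,\lambda)$-antifield, i.e. that the set $X=\{x:(x,y)\in P\}$ satisfies $|X\cap(aG+b)|\le\max\{\lambda,|G|^{1/2}\}$ for all subfields $G$ of $F$ and all $a,b\in F$ (with $|G|^{1/2}=\infty$ if $G$ is infinite). Then $$T\le C\max\left\{|A|^{\frac{643}{321}}|B|^{\frac{961}{321}},\ |A|^{\frac{535}{267}}|B|^{\frac{799}{267}},\ |A|^{\frac{499}{249}}|B|^{\frac{743}{249}}\right\}.$$ -/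

import Mathlib

open scoped ENNReal

namespace Antifield

variable {F : Type*} [Field F]

/-- `A ⊆ F` is a `(1, lam)`-antifield: `|A ∩ (aG + b)| ≤ max {lam, |G|^(1/2)}` for all subfields
`G` of `F` and all `a b : F`. The cardinalities are extended, so that an infinite subfield has
`|G|^(1/2) = ∞`. -/
def IsOneAntifield (lam : ℝ) (A : Set F) : Prop :=
  ∀ (G : Subfield F) (a b : F),
    ((A ∩ (fun g : F => a * g + b) '' (G : Set F)).encard : ℝ≥0∞) ≤
      max (ENNReal.ofReal lam) (((G : Set F).encard : ℝ≥0∞) ^ (1 / 2 : ℝ))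

/-- `P ⊆ F × F` is a `(2, lam)`-antifield: the set `{x : (x, y) ∈ P}` of its first coordinates is
a `(1, lam)`-antifield. -/
def IsTwoAntifield (lam : ℝ) (P : Set (F × F)) : Prop :=
  IsOneAntifield lam {x : F | ∃ y : F, (x, y) ∈ P}

/-- The line through the origin with gradient `a`. -/
def originLine (a : F) : AffineSubspace F (F × F) := line[F, ((0 : F), (0 : F)), ((1 : F), a)]

/-- The horizontal line with `y`-intercept `b`. -/
def horizontalLine (b : F) : AffineSubspace F (F × F) := line[F, ((0 : F), b), ((1 : F), b)]

theorem mem_originLine {a : F} {p : F × F} : p ∈ originLine a ↔ p.2 = a * p.1 := by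
  obtain ⟨x, y⟩ := p
  simp only [originLine, mem_affineSpan_pair_iff_exists_lineMap_eq, AffineMap.lineMap_apply]
  constructor
  · rintro ⟨r, hr⟩
    simp [Prod.ext_iff] at hr
    rw [← hr.1, ← hr.2]; ring
  · intro h
    refine ⟨x, ?_⟩
    simp [h, mul_comm]

theorem mem_horizontalLine {b : F} {p : F × F} : p ∈ horizontalLine b ↔ p.2 = b := by
  obtain ⟨x, y⟩ := p
  simp only [horizontalLine, mem_affineSpan_pair_iff_exists_lineMap_eq, AffineMap.lineMap_apply]
  constructor
  · rintro ⟨r, hr⟩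
    simp [Prod.ext_iff] at hr
    exact hr.2.symm
  · intro h
    refine ⟨x, ?_⟩
    simp [h]

/-- `L(P)`: the set of lines determined by pairs of (distinct) points of `P`. -/
def determinedLines (P : Set (F × F)) : Set (AffineSubspace F (F × F)) :=
  {l | ∃ p ∈ P, ∃ q ∈ P, p ≠ q ∧ l = line[F, p, q]}

/-- `I_k(P, L)`: the number of `(p₁, …, p_k, l) ∈ P^k × L` with `p₁, …, p_k ∈ l`. -/
noncomputable def collinearTuples (k : ℕ) (P : Set (F × F))
    (L : Set (AffineSubspace F (F × F))) : ℕ :=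
  Set.ncard {t : (Fin k → F × F) × AffineSubspace F (F × F) |
    (∀ i, t.1 i ∈ P) ∧ t.2 ∈ L ∧ ∀ i, t.1 i ∈ t.2}

end Antifield

namespace Antifield
open scoped Pointwise
open Finset

/-! A point of `P` is written `(u y, y)` with `u = a⁻¹`. Three such points are collinear exactly
when the points `(uᵢ, yᵢ⁻¹)` are, so for fixed `y₁ ≠ y₃` collinearity reads `(1 + x) u₃ = x u₁ +
u₂`, where `x` depends on `y₂` alone. Put `T = 4ρ|A|²|B|³`. If `T` beats the claimed bound,
degenerate triples are negligible, and pigeonholing the two outer heights leaves a proportion `ρ` of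
all `(x, u₁, u₂)` for which `x u₁ + u₂` falls in `(1 + x) U`, a set of only `|A|` elements.

`uniform_bsg` converts this into one set `Z ⊆ U` and sets `W x ⊆ U` with every `x Z + W x` small.
`exists_pivot` fixes an `x₁` for which many `W x` meet `W x₁` substantially, and Ruzsa's triangle
inequality makes `Z ± (x / x₁) Z` small. Pigeonholing `(u₁, u₃)` makes `u₂` an affine function of
`x`, so the multipliers `x / x₁` are an affine image of a large `Y ⊆ U`; `exists_fiber_subset` then
places `Y` in a single row of `P`.

The sum-product input is `card_sq_le_or_exists_subfield`: either `|Y|² ≪ ρ⁻²¹⁶|A|`, or `Y` lies in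
an affine image of a subfield with fewer than `|Y|²` elements. Since `|Y| ≥ ρ⁵|B|/96`, the first
case bounds `ρ` and hence `T`; the second contradicts the antifield hypothesis, as `λ = ρ⁶⁵|B|/97`.
Only the first of the three terms in the maximum is needed. -/

theorem card_mul_le_card_of_le_card_fiber {α β : Type*} [DecidableEq β] {S : Finset α}
    {T : Finset β} (f : α → β) {c : ℝ}
    (h : ∀ s ∈ T, c ≤ #(S.filter fun t => f t = s)) : #T * c ≤ #S := by
  calc #T * c = ∑ s ∈ T, c := by simp
    _ ≤ ∑ s ∈ T, (#(S.filter fun t => f t = s) : ℝ) := sum_le_sum h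
    _ ≤ #S := by
      rw [← Nat.cast_sum, sum_card_fiberwise_eq_card_filter]
      exact_mod_cast card_filter_le _ _

/-! ### Balog–Szemerédi–Gowers, uniformly over dilates. -/

set_option maxHeartbeats 800000 in
/-- A version of the Balog–Szemerédi–Gowers theorem that is uniform over a family of dilates. If the bipartite graphs
`H x` on `A × A` have density at least `δ` on average over `x ∈ X`, and `x * u + w` takes at most
`|A|` values along the edges of `H x`, then a single set `A'` has small sums `x A' + W x` with sets
`W x` supporting a proportion `δ ^ 2 / 4` of all triples. -/
theorem uniform_bsg {F : Type*} [Field F] [DecidableEq F] (X A : Finset F) (H : F → F → F → Prop)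
    [∀ x u w, Decidable (H x u w)] {δ : ℝ} (hδ : 0 < δ) (hX : (0 : F) ∉ X)
    (hS : ∀ x ∈ X, ∃ S : Finset F, #S ≤ #A ∧ ∀ u ∈ A, ∀ w ∈ A, H x u w → x * u + w ∈ S)
    (hH : δ * #A ^ 2 * #X ≤ ∑ x ∈ X, ∑ u ∈ A, ∑ w ∈ A, if H x u w then (1 : ℝ) else 0)
    (hA : A.Nonempty) (hX' : X.Nonempty) :
    ∃ A' ⊆ A, ∃ W : F → Finset F, (∀ x, W x ⊆ A) ∧
      δ ^ 2 / 4 * #A ^ 2 * #X ≤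
        ∑ x ∈ X, ∑ u ∈ A', ∑ w ∈ W x, (if H x u w then (1 : ℝ) else 0) ∧
      ∀ x ∈ X, (#(image (fun u => x * u) A' + W x) : ℝ) ≤ 128 / δ ^ 6 * #A := by
  have ha : (0 : ℝ) < #A := by exact_mod_cast hA.card_pos
  have hb : (0 : ℝ) < #X := by exact_mod_cast hX'.card_pos
  set a : ℝ := (#A : ℝ) with ha_def
  set b : ℝ := (#X : ℝ) with hb_def
  set h : F → F → F → ℝ := fun x u w => if H x u w then (1 : ℝ) else 0 with h_def
  have h0 : ∀ x u w, 0 ≤ h x u w := by intro x u w; simp only [h]; split_ifs <;> norm_num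
  have h1 : ∀ x u w, h x u w ≤ 1 := by intro x u w; simp only [h]; split_ifs <;> norm_num
  -- A pair `u, u'` is bad when it has fewer than `τ` common neighbours; `σ` caps the bad partners
  -- allowed to `u`. The values make the loss `(a b / σ) (b a² τ)` exactly half of the main term `δ²
  -- a³ b²`.
  set σ : ℝ := δ ^ 2 * a / 8 with hσ
  set τ : ℝ := δ ^ 4 * a / 16 with hτ
  have hσ0 : 0 < σ := by positivity
  have hτ0 : 0 < τ := by positivity
  -- Weighting by the degree over all `x` at once is what lets a single `A'` serve every dilate.
  set D : F → ℝ := fun u => ∑ x ∈ X, ∑ w ∈ A, h x u w with hD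
  have hD0 : ∀ u, 0 ≤ D u := fun u => sum_nonneg fun _ _ => sum_nonneg fun _ _ => h0 _ _ _
  have hD1 : ∀ u, D u ≤ a * b := by
    intro u
    calc D u ≤ ∑ x ∈ X, ∑ w ∈ A, (1 : ℝ) := sum_le_sum fun _ _ => sum_le_sum fun _ _ => h1 _ _ _
      _ = a * b := by simp [ha_def, hb_def, mul_comm]
  set cod : F → F → F → ℝ := fun x u u' => ∑ w ∈ A, h x u w * h x u' w with hcod
  set bad : F → F → F → ℝ := fun x u u' => if cod x u u' < τ then 1 else 0 with hbad
  set β : F → F → F → ℝ := fun x w u => ∑ u' ∈ A, h x u' w * bad x u u' with hβ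
  have hβ0 : ∀ x w u, 0 ≤ β x w u := by
    intro x w u
    refine sum_nonneg fun u' _ => mul_nonneg (h0 _ _ _) ?_
    simp only [hbad]; split_ifs <;> norm_num
  have hβsum : ∑ x ∈ X, ∑ w ∈ A, ∑ u ∈ A, h x u w * β x w u ≤ b * a ^ 2 * τ := by
    have : ∀ x ∈ X, ∑ w ∈ A, ∑ u ∈ A, h x u w * β x w u ≤ a ^ 2 * τ := by
      intro x _
      calc ∑ w ∈ A, ∑ u ∈ A, h x u w * β x w u
          = ∑ u ∈ A, ∑ u' ∈ A, bad x u u' * cod x u u' := by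
            rw [sum_comm]
            refine sum_congr rfl fun u _ => ?_
            simp only [hβ, hcod, mul_sum]
            rw [sum_comm]
            refine sum_congr rfl fun u' _ => sum_congr rfl fun w _ => by ring
        _ ≤ ∑ u ∈ A, ∑ u' ∈ A, τ := by
            refine sum_le_sum fun u _ => sum_le_sum fun u' _ => ?_
            simp only [hbad]
            split_ifs with hc
            · simpa using hc.le
            · simpa using hτ0.le
        _ = a ^ 2 * τ := by simp [ha_def]; ring
    calc _ ≤ ∑ x ∈ X, a ^ 2 * τ := sum_le_sum this
      _ = b * a ^ 2 * τ := by simp [hb_def]; ring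
  have hDsum : ∑ u ∈ A, D u = ∑ x ∈ X, ∑ u ∈ A, ∑ w ∈ A, h x u w := by
    simp only [hD]; rw [sum_comm]
  have hDsq : δ ^ 2 * a ^ 3 * b ^ 2 ≤ ∑ u ∈ A, D u ^ 2 := by
    have h3 := sq_sum_le_card_mul_sum_sq (s := A) (f := D)
    have h4 : (δ * a ^ 2 * b) ^ 2 ≤ (∑ u ∈ A, D u) ^ 2 := by
      rw [hDsum]; gcongr
    have h5 : a * (δ ^ 2 * a ^ 3 * b ^ 2) ≤ a * ∑ u ∈ A, D u ^ 2 := by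
      calc _ = (δ * a ^ 2 * b) ^ 2 := by ring
        _ ≤ _ := h4.trans h3
    exact le_of_mul_le_mul_left h5 ha
  have hDsq' : ∑ x ∈ X, ∑ w ∈ A, ∑ u ∈ A, h x u w * D u = ∑ u ∈ A, D u ^ 2 := by
    calc _ = ∑ x ∈ X, ∑ u ∈ A, ∑ w ∈ A, h x u w * D u :=
          sum_congr rfl fun x _ => sum_comm
      _ = ∑ u ∈ A, ∑ x ∈ X, ∑ w ∈ A, h x u w * D u := sum_comm
      _ = ∑ u ∈ A, D u ^ 2 := by
          refine sum_congr rfl fun u _ => ?_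
          simp only [← sum_mul, sq, D]
  obtain ⟨x₀, hx₀, w₀, hw₀, hx₀w₀⟩ : ∃ x₀ ∈ X, ∃ w₀ ∈ A, δ ^ 2 / 2 * a ^ 2 * b ≤
      ∑ u ∈ A, h x₀ u w₀ * D u * (if β x₀ w₀ u < σ then 1 else 0) := by
    by_contra! hcon
    have key : ∑ x ∈ X, ∑ w ∈ A, ∑ u ∈ A, h x u w * D u ≤
        ∑ x ∈ X, ∑ w ∈ A, ∑ u ∈ A, h x u w * D u * (if β x w u < σ then 1 else 0) +
        a * b / σ * ∑ x ∈ X, ∑ w ∈ A, ∑ u ∈ A, h x u w * β x w u := by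
      simp only [mul_sum, ← sum_add_distrib]
      refine sum_le_sum fun x _ => sum_le_sum fun w _ => sum_le_sum fun u _ => ?_
      split_ifs with hc
      · have := h0 x u w
        have := hβ0 x w u
        have : 0 ≤ a * b / σ * (h x u w * β x w u) := by positivity
        linarith
      · rw [mul_zero, zero_add]
        calc h x u w * D u ≤ h x u w * (a * b) := mul_le_mul_of_nonneg_left (hD1 u) (h0 _ _ _)
          _ = a * b / σ * (h x u w * σ) := by field_simp
          _ ≤ _ := by
            have := h0 x u w
            gcongr
            exact not_lt.1 hc
    have hlt : ∑ x ∈ X, ∑ w ∈ A, ∑ u ∈ A, h x u w * D u * (if β x w u < σ then 1 else 0) <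
        b * (a * (δ ^ 2 / 2 * a ^ 2 * b)) := by
      calc _ < ∑ x ∈ X, ∑ w ∈ A, δ ^ 2 / 2 * a ^ 2 * b := by
            exact sum_lt_sum_of_nonempty hX' fun x hx => sum_lt_sum_of_nonempty hA fun w hw =>
              hcon x hx w hw
        _ = _ := by simp [ha_def, hb_def]
    have h6 : a * b / σ * ∑ x ∈ X, ∑ w ∈ A, ∑ u ∈ A, h x u w * β x w u ≤
        a * b / σ * (b * a ^ 2 * τ) := by gcongr
    have h7 : a * b / σ * (b * a ^ 2 * τ) = b * (a * (δ ^ 2 / 2 * a ^ 2 * b)) := by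
      rw [hσ, hτ]; field_simp; norm_num
    rw [hDsq'] at key
    nlinarith
  classical
  set A' : Finset F := A.filter fun u => H x₀ u w₀ ∧ β x₀ w₀ u < σ with hA'
  have hA'sum : δ ^ 2 / 2 * a ^ 2 * b ≤ ∑ u ∈ A', D u := by
    refine hx₀w₀.trans (le_of_eq ?_)
    rw [hA', sum_filter]
    refine sum_congr rfl fun u _ => ?_
    simp only [h]
    by_cases h2 : H x₀ u w₀ <;> by_cases h3 : β x₀ w₀ u < σ <;> simp [h2, h3]
  -- Of the `2σ` neighbours in `A'`, fewer than `σ` can be bad partners of a given `u ∈ A'`, so at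
  -- least `σ` remain. The edges discarded here number at most `2σab = δ²a²b/4`, half of what `A'`
  -- carries.
  set W : F → Finset F := fun x => A.filter fun w => 2 * σ ≤ ∑ u ∈ A', h x u w with hW
  refine ⟨A', filter_subset _ _, W, fun x => filter_subset _ _, ?_, ?_⟩
  · have e1 : ∑ u ∈ A', D u = ∑ x ∈ X, ∑ w ∈ A, ∑ u ∈ A', h x u w := by
      simp only [hD]
      rw [sum_comm]
      exact sum_congr rfl fun x _ => sum_comm
    have e2 : ∀ x ∈ X, ∑ w ∈ A, ∑ u ∈ A', h x u w ≤
        ∑ u ∈ A', ∑ w ∈ W x, h x u w + a * (2 * σ) := by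
      intro x _
      rw [sum_comm (s := A') (t := W x), hW, sum_filter]
      have : a * (2 * σ) = ∑ w ∈ A, 2 * σ := by simp [ha_def]
      rw [this, ← sum_add_distrib]
      refine sum_le_sum fun w _ => ?_
      split_ifs with hc
      · linarith
      · linarith
    have e3 := sum_le_sum e2
    rw [← e1, sum_add_distrib] at e3
    have e4 : ∑ x ∈ X, a * (2 * σ) = δ ^ 2 / 4 * a ^ 2 * b := by
      simp [hb_def, hσ]; ring
    rw [e4] at e3
    linarith
  · intro x hx
    obtain ⟨S, hSc, hS'⟩ := hS x hx
    obtain ⟨S₀, hS₀c, hS₀'⟩ := hS x₀ hx₀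
    have hx0 : x ≠ 0 := fun h => hX (h ▸ hx)
    have hx₀0 : x₀ ≠ 0 := fun h => hX (h ▸ hx₀)
    -- The identity `x u + w = (x / x₀) ((x₀ u + z) - (x₀ u' + z)) + (x u' + w)` represents each sum
    -- by a triple in `S₀ × S₀ × S`, once for every path `u – z – u' – w` with two edges in `H x₀`
    -- and the last in `H x`.
    set f : F × F × F → F := fun s => x / x₀ * (s.1 - s.2.1) + s.2.2 with hf
    set 𝒮 : Finset (F × F × F) := S₀ ×ˢ S₀ ×ˢ S with h𝒮
    have hfib : ∀ s ∈ image (fun u => x * u) A' + W x,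
        σ * τ ≤ #(𝒮.filter fun t => f t = s) := by
      intro s hs
      obtain ⟨_, hs', w, hw, rfl⟩ := mem_add.1 hs
      obtain ⟨u, hu, rfl⟩ := mem_image.1 hs'
      have huA : u ∈ A := (mem_filter.1 hu).1
      have hwA : w ∈ A := (mem_filter.1 hw).1
      have hwσ : 2 * σ ≤ ∑ u ∈ A', h x u w := (mem_filter.1 hw).2
      have huβ : β x₀ w₀ u < σ := (mem_filter.1 hu).2.2
      set E : Finset (F × F) := (A' ×ˢ A).filter fun p =>
        H x p.1 w ∧ H x₀ u p.2 ∧ H x₀ p.1 p.2 with hE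
      have hEcard : σ * τ ≤ #E := by
        have hEsum : (#E : ℝ) = ∑ u' ∈ A', h x u' w * cod x₀ u u' := by
          rw [hE, card_filter, sum_product]
          push_cast
          refine sum_congr rfl fun u' _ => ?_
          simp only [hcod, mul_sum]
          refine sum_congr rfl fun z _ => ?_
          simp only [h]
          by_cases i1 : H x u' w <;> by_cases i2 : H x₀ u z <;> by_cases i3 : H x₀ u' z <;>
            simp [i1, i2, i3]
        rw [hEsum]
        have g1 : ∑ u' ∈ A', h x u' w * (1 - bad x₀ u u') ≥ σ := by
          have g2 : ∑ u' ∈ A', h x u' w * bad x₀ u u' ≤ β x₀ w₀ u := by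
            calc ∑ u' ∈ A', h x u' w * bad x₀ u u' ≤ ∑ u' ∈ A', h x₀ u' w₀ * bad x₀ u u' := by
                  refine sum_le_sum fun u' hu' => ?_
                  have : h x₀ u' w₀ = 1 := by simp [h, (mem_filter.1 hu').2.1]
                  rw [this]
                  refine mul_le_mul_of_nonneg_right (h1 _ _ _) ?_
                  simp only [hbad]; split_ifs <;> norm_num
              _ ≤ _ := by
                  refine sum_le_sum_of_subset_of_nonneg (filter_subset _ _) fun u' _ _ =>
                    mul_nonneg (h0 _ _ _) ?_
                  simp only [hbad]; split_ifs <;> norm_num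
          simp only [mul_sub, mul_one, sum_sub_distrib]
          linarith
        calc σ * τ ≤ (∑ u' ∈ A', h x u' w * (1 - bad x₀ u u')) * τ := by gcongr
          _ ≤ _ := by
            rw [sum_mul]
            refine sum_le_sum fun u' _ => ?_
            rw [mul_assoc]
            refine mul_le_mul_of_nonneg_left ?_ (h0 _ _ _)
            simp only [hbad]
            split_ifs with hc
            · simpa using sum_nonneg fun z _ => mul_nonneg (h0 _ _ _) (h0 _ _ _)
            · simpa using hc
      refine hEcard.trans ?_
      norm_cast
      refine card_le_card_of_injOn (fun p => (x₀ * u + p.2, x₀ * p.1 + p.2, x * p.1 + w)) ?_ ?_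
      · rintro ⟨u', z⟩ hp
        obtain ⟨hp1, i1, i2, i3⟩ := mem_filter.1 (mem_coe.1 hp)
        obtain ⟨hu', hz⟩ := mem_product.1 hp1
        have hu'A : u' ∈ A := (mem_filter.1 hu').1
        rw [mem_coe, mem_filter, h𝒮]
        refine ⟨mem_product.2 ⟨hS₀' _ huA _ hz i2, mem_product.2 ⟨hS₀' _ hu'A _ hz i3,
          hS' _ hu'A _ hwA i1⟩⟩, ?_⟩
        simp only [hf]
        field_simp
        ring
      · rintro ⟨u', z⟩ _ ⟨u'', z'⟩ _ heq
        simp only [Prod.mk.injEq] at heq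
        obtain ⟨q1, -, q3⟩ := heq
        have : u' = u'' := mul_left_cancel₀ hx0 (add_right_cancel q3)
        have : z = z' := add_left_cancel q1
        simp [*]
    have hcount : (#(image (fun u => x * u) A' + W x) : ℝ) * (σ * τ) ≤ a ^ 3 := by
      refine (card_mul_le_card_of_le_card_fiber f hfib).trans ?_
      rw [h𝒮, card_product, card_product]
      push_cast
      have r1 : (#S : ℝ) ≤ a := by rw [ha_def]; exact_mod_cast hSc
      have r2 : (#S₀ : ℝ) ≤ a := by rw [ha_def]; exact_mod_cast hS₀c
      calc (#S₀ : ℝ) * (#S₀ * #S) ≤ a * (a * a) := by gcongr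
        _ = a ^ 3 := by ring
    have hστ : σ * τ = δ ^ 6 * a ^ 2 / 128 := by rw [hσ, hτ]; ring
    rw [← le_div_iff₀ (by positivity)] at hcount
    refine hcount.trans (le_of_eq ?_)
    rw [hστ]
    field_simp

/-! ### Sum-product growth through the quotient set. -/

section Growth

variable {F : Type*} [Field F] [DecidableEq F]

theorem card_smul_finset_of_ne_zero {c : F} (hc : c ≠ 0) (S : Finset F) : #(c • S) = #S :=
  card_image_of_injective _ fun x y h => mul_left_cancel₀ hc (by simpa using h)

theorem card_smul_add_smul {c : F} (hc : c ≠ 0) (S T : Finset F) :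
    #(c • S + c • T) = #(S + T) := by
  rw [← card_smul_finset_of_ne_zero hc (S + T)]
  congr 1
  ext x
  simp only [mem_add, mem_smul_finset, smul_eq_mul]
  constructor
  · rintro ⟨_, ⟨s, hs, rfl⟩, _, ⟨t, ht, rfl⟩, rfl⟩
    exact ⟨s + t, ⟨s, hs, t, ht, rfl⟩, by ring⟩
  · rintro ⟨_, ⟨s, hs, t, ht, rfl⟩, rfl⟩
    exact ⟨_, ⟨s, hs, rfl⟩, _, ⟨t, ht, rfl⟩, by ring⟩

/-- Ruzsa's triangle inequality through a dilate of `Z`. -/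
theorem card_add_smul_mul_card_le {y : F} (hy : y ≠ 0) (Z W : Finset F) :
    #(Z + y • W) * #Z ≤ #(Z + y • Z) * #(Z + W) := by
  have := ruzsa_triangle_inequality_add_add_add Z (y • Z) (y • W)
  rwa [card_smul_finset_of_ne_zero hy, card_smul_add_smul hy] at this

/-- Allowing `W` to be a dilate already makes this iterable: each further multiplier costs one
factor `K`. -/
theorem card_add_smul_le {y : F} (hy : y ≠ 0) {Z W : Finset F} (hZ : Z.Nonempty) {K L : ℝ}
    (hK : #(Z + y • Z) ≤ K * #Z) (hL : #(Z + W) ≤ L * #Z) :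
    (#(Z + y • W) : ℝ) ≤ K * L * #Z := by
  have hz : (0 : ℝ) < #Z := by exact_mod_cast hZ.card_pos
  have h := card_add_smul_mul_card_le hy Z W
  have h' : (#(Z + y • W) : ℝ) * #Z ≤ #(Z + y • Z) * #(Z + W) := by exact_mod_cast h
  refine le_of_mul_le_mul_right (h'.trans ?_) hz
  calc (#(Z + y • Z) : ℝ) * #(Z + W) ≤ (K * #Z) * (L * #Z) := by
        gcongr
        exact (Nat.cast_nonneg _).trans hK
    _ = _ := by ring

/-- The Plünnecke–Ruzsa inequality for a family of dilates of `W`. -/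
theorem card_nsmul_mul_le {Z W T : Finset F} (hZ : Z.Nonempty) {M : ℝ}
    (h : ∀ t ∈ T, (#(Z + t • W) : ℝ) ≤ M * #Z) (n : ℕ) :
    (#(n • (T * W)) : ℝ) ≤ (#T * M) ^ n * #Z := by
  have hz : (0 : ℝ) < #Z := by exact_mod_cast hZ.card_pos
  have h1 : (#(Z + T * W) : ℝ) ≤ #T * M * #Z := by
    have h2 : Z + T * W ⊆ T.biUnion fun t => Z + t • W := by
      intro x hx
      obtain ⟨z, hz, _, hy, rfl⟩ := mem_add.1 hx
      obtain ⟨t, ht, w, hw, rfl⟩ := mem_mul.1 hy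
      exact mem_biUnion.2 ⟨t, ht, add_mem_add hz (mem_smul_finset.2 ⟨w, hw, rfl⟩)⟩
    calc (#(Z + T * W) : ℝ) ≤ ∑ t ∈ T, (#(Z + t • W) : ℝ) := by
          exact_mod_cast (card_le_card h2).trans card_biUnion_le
      _ ≤ ∑ t ∈ T, M * #Z := sum_le_sum h
      _ = _ := by simp; ring
  have h3 := pluennecke_ruzsa_inequality_nsmul_add hZ (T * W) n
  have h4 : (#(n • (T * W)) : ℝ) ≤ (#(Z + T * W) / #Z : ℝ) ^ n * #Z := by
    have := (NNRat.cast_le (K := ℝ)).2 h3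
    push_cast at this
    exact this
  refine h4.trans ?_
  gcongr
  rwa [div_le_iff₀ hz]

/-- The quotient set `(S - S) / (S - S)`. -/
def quotientSet (S : Finset F) : Set F :=
  {r | ∃ y₁ ∈ S, ∃ y₂ ∈ S, ∃ y₃ ∈ S, ∃ y₄ ∈ S, y₃ ≠ y₄ ∧ r = (y₁ - y₂) / (y₃ - y₄)}

theorem finite_quotientSet (S : Finset F) : (quotientSet S).Finite := by
  refine (S ×ˢ S ×ˢ S ×ˢ S |>.image fun p => (p.1 - p.2.1) / (p.2.2.1 - p.2.2.2)).finite_toSet.subset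
    ?_
  rintro r ⟨y₁, h₁, y₂, h₂, y₃, h₃, y₄, h₄, -, rfl⟩
  exact mem_coe.2 (mem_image.2 ⟨(y₁, y₂, y₃, y₄), by simp [*], rfl⟩)

/-- A collision `a + r b = c + r d` with `b ≠ d` would exhibit `r` as a quotient of differences, so
`(a, b) ↦ a + r b` is injective on `S × S`. -/
theorem card_add_smul_of_notMem_quotientSet {S : Finset F} {r : F} (hS : 1 < #S)
    (hr : r ∉ quotientSet S) : #(S + r • S) = #S ^ 2 := by
  obtain ⟨x, hx, y, hy, hxy⟩ := one_lt_card.1 hS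
  have hr0 : r ≠ 0 := by
    rintro rfl
    exact hr ⟨x, hx, x, hx, x, hx, y, hy, hxy, by simp⟩
  have : #(S + r • S) = #S * #(r • S) := by
    refine card_add_iff.2 ?_
    rintro ⟨a, b⟩ hab ⟨c, d⟩ hcd h
    obtain ⟨ha, hb⟩ := hab
    obtain ⟨hc, hd⟩ := hcd
    obtain ⟨b, hb', rfl⟩ := mem_smul_finset.1 (mem_coe.1 hb)
    obtain ⟨d, hd', rfl⟩ := mem_smul_finset.1 (mem_coe.1 hd)
    simp only [smul_eq_mul] at h ⊢
    have ha' : a ∈ S := ha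
    have hc' : c ∈ S := hc
    by_cases hbd : b = d
    · subst hbd
      rw [add_right_cancel h]
    · refine absurd ⟨c, hc', a, ha', b, hb', d, hd', hbd, ?_⟩ hr
      rw [eq_div_iff (sub_ne_zero.2 hbd)]
      linear_combination h
  rw [this, card_smul_finset_of_ne_zero hr0, sq]

/-- If the quotient set is stable under adding `1` and under multiplication by elements of `S`,
then it is a subfield containing `S`. -/
theorem exists_subfield_of_quotientSet_stable {F : Type*} [Field F] {S : Finset F} (hS : 1 < #S)
    (hadd : ∀ r ∈ quotientSet S, r + 1 ∈ quotientSet S)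
    (hmul : ∀ r ∈ quotientSet S, ∀ y ∈ S, r * y ∈ quotientSet S) :
    ∃ G : Subfield F, (G : Set F) = quotientSet S ∧ ↑S ⊆ (G : Set F) := by
  obtain ⟨x, hx, y, hy, hxy⟩ := one_lt_card.1 hS
  classical
  have hfin := finite_quotientSet S
  set R := quotientSet S with hR
  have h0 : (0 : F) ∈ R := ⟨x, hx, x, hx, x, hx, y, hy, hxy, by simp⟩
  have surj : ∀ f : F → F, f.Injective → (∀ r ∈ R, f r ∈ R) → ∀ r ∈ R, ∃ s ∈ R, f s = r := by
    intro f hf hfR r hr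
    have hsub : f '' R ⊆ R := Set.image_subset_iff.2 hfR
    have h := Set.eq_of_subset_of_ncard_le hsub
      (Set.ncard_image_of_injective R hf).ge hfin
    rw [← h] at hr
    exact hr
  -- `N` and `M` are the additive and multiplicative stabilisers of the finite set `R`. Finiteness
  -- makes an injective self-map of `R` onto, which supplies negatives in `N`.
  let N : AddSubgroup F :=
    { carrier := {n | ∀ r ∈ R, r + n ∈ R}
      zero_mem' := by intro r hr; simpa using hr
      add_mem' := by
        intro m n hm hn r hr
        rw [← add_assoc]
        exact hn _ (hm r hr)
      neg_mem' := by
        intro n hn r hr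
        obtain ⟨s, hs, rfl⟩ := surj (fun s => s + n) (add_left_injective n) hn r hr
        simpa using hs }
  let M : Submonoid F :=
    { carrier := {m | ∀ r ∈ R, r * m ∈ R}
      one_mem' := by intro r hr; simpa using hr
      mul_mem' := by
        intro m n hm hn r hr
        rw [← mul_assoc]
        exact hn _ (hm r hr) }
  -- Distributivity links the two: an element of `R` has the form `s m`, and `s m + m = (s + 1) m`.
  -- Hence the ring generated by `S` lies in `N`, and so in `R` because `0 ∈ R`.
  have hMN : ∀ m ∈ M, m ∈ N := by
    intro m hm r hr
    rcases eq_or_ne m 0 with rfl | hm0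
    · simpa using hr
    · obtain ⟨s, hs, rfl⟩ := surj (fun s => s * m) (mul_left_injective₀ hm0) hm r hr
      have : s * m + m = (s + 1) * m := by ring
      rw [this]
      exact hm _ (hadd s hs)
  have hSM : Submonoid.closure (S : Set F) ≤ M :=
    Submonoid.closure_le.2 fun y hy r hr => hmul r hr y hy
  have hcl : (Subring.closure (S : Set F) : Set F) ⊆ R := by
    intro z hz
    rw [SetLike.mem_coe, Subring.mem_closure_iff] at hz
    have hzN : z ∈ N := (AddSubgroup.closure_le N).2 (fun m hm => hMN m (hSM hm)) hz
    simpa using hzN 0 h0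
  have hfinite : Finite (Subring.closure (S : Set F)) := (hfin.subset hcl).to_subtype
  have hfield : IsField (Subring.closure (S : Set F)) := Finite.isField_of_domain _
  let G : Subfield F :=
    { Subring.closure (S : Set F) with
      inv_mem' := by
        intro z hz
        rcases eq_or_ne z 0 with rfl | hz0
        · simp
        · obtain ⟨w, hw⟩ := hfield.mul_inv_cancel (a := ⟨z, hz⟩) (by simpa [Subtype.ext_iff] using hz0)
          have hw' : z * w = 1 := by simpa [Subtype.ext_iff] using hw
          rw [← eq_inv_of_mul_eq_one_right hw']
          exact w.2 }
  have hSG : ↑S ⊆ (G : Set F) := Subring.subset_closure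
  refine ⟨G, Set.Subset.antisymm hcl ?_, hSG⟩
  rintro r ⟨y₁, h₁, y₂, h₂, y₃, h₃, y₄, h₄, -, rfl⟩
  exact G.div_mem (G.sub_mem (hSG h₁) (hSG h₂)) (G.sub_mem (hSG h₃) (hSG h₄))

/-- Average the additive energy `E r` over `r ∈ G`. Distinct pairs collide for at most one `r`, so
the total is at most `|G||S|² + |S|⁴ ≤ 2|G||S|²`; Cauchy–Schwarz finishes for an `r` of at most
average energy. -/
theorem exists_card_sq_le_two_mul_card_add_smul {S G : Finset F} (hSG : #S ^ 2 ≤ #G)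
    (hS : S.Nonempty) : ∃ r ∈ G, #S ^ 2 ≤ 2 * #(S + r • S) := by
  have hs : (0 : ℝ) < #S := by exact_mod_cast hS.card_pos
  have hSG' : (#S : ℝ) ^ 2 ≤ #G := by exact_mod_cast hSG
  have hG : G.Nonempty := by
    rw [← card_pos]
    exact lt_of_lt_of_le (pow_pos hS.card_pos 2) hSG
  set E : F → ℝ := fun r => ∑ p ∈ S ×ˢ S, ∑ q ∈ S ×ˢ S,
    if p.1 + r * p.2 = q.1 + r * q.2 then (1 : ℝ) else 0 with hE
  have hsum : ∑ r ∈ G, E r ≤ ∑ r ∈ G, 2 * (#S : ℝ) ^ 2 := by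
    have h1 : ∀ p ∈ S ×ˢ S, ∑ q ∈ S ×ˢ S, ∑ r ∈ G,
        (if p.1 + r * p.2 = q.1 + r * q.2 then (1 : ℝ) else 0) ≤ 2 * #G := by
      intro p hp
      have h2 : ∀ q ∈ S ×ˢ S, ∑ r ∈ G,
          (if p.1 + r * p.2 = q.1 + r * q.2 then (1 : ℝ) else 0) ≤
          (if q = p then (#G : ℝ) else 0) + 1 := by
        intro q _
        rw [← sum_filter, sum_const, nsmul_one]
        by_cases hqp : q = p
        · rw [if_pos hqp]
          have : (#(G.filter fun r => p.1 + r * p.2 = q.1 + r * q.2) : ℝ) ≤ #G := by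
            exact_mod_cast card_filter_le _ _
          linarith
        · rw [if_neg hqp, zero_add]
          norm_cast
          refine card_le_one.2 ?_
          intro r hr r' hr'
          have e1 := (mem_filter.1 hr).2
          have e2 := (mem_filter.1 hr').2
          have h3 : p.2 - q.2 ≠ 0 := by
            intro h4
            have h5 : p.2 = q.2 := sub_eq_zero.1 h4
            rw [h5] at e1
            exact hqp (Prod.ext (add_right_cancel e1).symm h5.symm)
          exact mul_right_cancel₀ h3 (by linear_combination e1 - e2)
      refine (sum_le_sum h2).trans ?_
      rw [sum_add_distrib, sum_ite_eq' _ p, if_pos hp, sum_const, card_product, nsmul_one]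
      push_cast
      nlinarith
    calc ∑ r ∈ G, E r = ∑ p ∈ S ×ˢ S, ∑ q ∈ S ×ˢ S, ∑ r ∈ G,
          (if p.1 + r * p.2 = q.1 + r * q.2 then (1 : ℝ) else 0) := by
          simp only [hE]
          rw [sum_comm]
          exact sum_congr rfl fun p _ => sum_comm
      _ ≤ ∑ p ∈ S ×ˢ S, 2 * (#G : ℝ) := sum_le_sum h1
      _ = _ := by
        simp only [sum_const, card_product, nsmul_eq_mul]
        push_cast
        ring
  obtain ⟨r, hr, hEr⟩ := exists_le_of_sum_le hG hsum
  refine ⟨r, hr, ?_⟩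
  set T := S + r • S with hT
  have hmem : ∀ p ∈ S ×ˢ S, p.1 + r * p.2 ∈ T := fun p hp =>
    add_mem_add (mem_product.1 hp).1 (mem_smul_finset.2 ⟨p.2, (mem_product.1 hp).2, rfl⟩)
  have hcs := sq_sum_le_card_mul_sum_sq (s := T)
    (f := fun t => ∑ p ∈ S ×ˢ S, if p.1 + r * p.2 = t then (1 : ℝ) else 0)
  have hl : ∑ t ∈ T, ∑ p ∈ S ×ˢ S, (if p.1 + r * p.2 = t then (1 : ℝ) else 0) = #S ^ 2 := by
    rw [sum_comm]
    have : ∀ p ∈ S ×ˢ S, ∑ t ∈ T, (if p.1 + r * p.2 = t then (1 : ℝ) else 0) = 1 := by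
      intro p hp
      rw [sum_ite_eq, if_pos (hmem p hp)]
    rw [sum_congr rfl this]
    simp [card_product, sq]
  have hr' : ∑ t ∈ T, (∑ p ∈ S ×ˢ S, if p.1 + r * p.2 = t then (1 : ℝ) else 0) ^ 2 = E r := by
    simp only [sq, sum_mul_sum, hE]
    rw [sum_comm]
    refine sum_congr rfl fun p hp => ?_
    rw [sum_comm]
    refine sum_congr rfl fun q _ => ?_
    simp only [ite_mul, one_mul, zero_mul]
    rw [sum_ite_eq, if_pos (hmem p hp)]
    exact if_congr eq_comm rfl rfl
  rw [hl, hr'] at hcs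
  have : (#S : ℝ) ^ 2 ≤ 2 * #T := by
    have h5 : ((#S : ℝ) ^ 2) * #S ^ 2 ≤ (2 * #T) * #S ^ 2 := by
      calc ((#S : ℝ) ^ 2) * #S ^ 2 = (#S ^ 2) ^ 2 := by ring
        _ ≤ #T * E r := hcs
        _ ≤ #T * (2 * (#S : ℝ) ^ 2) := by gcongr
        _ = _ := by ring
    exact le_of_mul_le_mul_right h5 (by positivity)
  exact_mod_cast this

/-- Dilating by `y₃ - y₄` clears the denominator and expands `w + (r + 1) w'` into six terms of the
product set. -/
theorem card_add_smul_div_add_one_le {W : Finset F} {y₁ y₂ y₃ y₄ : F} (h : y₃ ≠ y₄) :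
    #(W + ((y₁ - y₂) / (y₃ - y₄) + 1) • W) ≤ #(6 • (({y₃, -y₄, y₁, -y₂} : Finset F) * W)) := by
  have hc : y₃ - y₄ ≠ 0 := sub_ne_zero.2 h
  rw [← card_smul_finset_of_ne_zero hc]
  refine card_le_card fun x hx => ?_
  obtain ⟨_, hx', rfl⟩ := mem_smul_finset.1 hx
  obtain ⟨w, hw, z, hz, rfl⟩ := mem_add.1 hx'
  obtain ⟨w', hw', rfl⟩ := mem_smul_finset.1 hz
  have : (y₃ - y₄) • (w + ((y₁ - y₂) / (y₃ - y₄) + 1) • w') =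
      0 + y₃ * w + -y₄ * w + y₃ * w' + -y₄ * w' + y₁ * w' + -y₂ * w' := by
    simp only [smul_eq_mul]; field_simp; ring
  rw [smul_eq_mul, smul_eq_mul] at this
  rw [smul_eq_mul, smul_eq_mul, this]
  simp only [succ_nsmul, zero_nsmul]
  refine add_mem_add (add_mem_add (add_mem_add (add_mem_add (add_mem_add (add_mem_add (zero_mem_zero) ?_) ?_) ?_) ?_) ?_) ?_ <;>
    exact mul_mem_mul (by simp) (by assumption)

theorem card_add_smul_div_mul_le {W : Finset F} {y₁ y₂ y₃ y₄ y : F} (h : y₃ ≠ y₄) :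
    #(W + ((y₁ - y₂) / (y₃ - y₄) * y) • W) ≤ #(4 • (({y₃, -y₄, y₁ * y, -y₂ * y} : Finset F) * W)) := by
  have hc : y₃ - y₄ ≠ 0 := sub_ne_zero.2 h
  rw [← card_smul_finset_of_ne_zero hc]
  refine card_le_card fun x hx => ?_
  obtain ⟨_, hx', rfl⟩ := mem_smul_finset.1 hx
  obtain ⟨w, hw, z, hz, rfl⟩ := mem_add.1 hx'
  obtain ⟨w', hw', rfl⟩ := mem_smul_finset.1 hz
  have : (y₃ - y₄) • (w + ((y₁ - y₂) / (y₃ - y₄) * y) • w') =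
      0 + y₃ * w + -y₄ * w + (y₁ * y) * w' + (-y₂ * y) * w' := by
    simp only [smul_eq_mul]; field_simp; ring
  rw [smul_eq_mul, smul_eq_mul] at this
  rw [smul_eq_mul, smul_eq_mul, this]
  simp only [succ_nsmul, zero_nsmul]
  refine add_mem_add (add_mem_add (add_mem_add (add_mem_add (zero_mem_zero) ?_) ?_) ?_) ?_ <;>
    exact mul_mem_mul (by simp) (by assumption)

set_option maxHeartbeats 400000 in
/-- Sum-product growth relative to an ambient set `Z` on which all elements of `S` act with small
sumsets: either `S` is small, or it lies in a subfield with fewer than `|S| ^ 2` elements. -/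
theorem card_sq_le_or_exists_subfield {Z S : Finset F} (hZ : Z.Nonempty) (hS0 : (0 : F) ∉ S)
    {κ : F} (hκ : κ ≠ 0) {Λ : ℝ} (hΛ : 1 ≤ Λ) (h1 : (#(Z + κ • S) : ℝ) ≤ Λ * #Z)
    (h2 : ∀ y ∈ S, (#(Z + y • Z) : ℝ) ≤ Λ * #Z) (h3 : ∀ y ∈ S, (#(Z + (-y) • Z) : ℝ) ≤ Λ * #Z) :
    (#S : ℝ) ^ 2 ≤ 8192 * Λ ^ 12 * #Z ∨
      ∃ G : Subfield F, (G : Set F).Finite ∧ ↑S ⊆ (G : Set F) ∧ (G : Set F).ncard < #S ^ 2 := by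
  have hz : (1 : ℝ) ≤ #Z := by exact_mod_cast hZ.card_pos
  have hΛ12 : (1 : ℝ) ≤ Λ ^ 12 := one_le_pow₀ hΛ
  rcases le_or_gt #S 1 with hS1 | hS1
  · left
    have : (#S : ℝ) ≤ 1 := by exact_mod_cast hS1
    have h0 : (0 : ℝ) ≤ #S := by positivity
    nlinarith
  have hne : ∀ y ∈ S, y ≠ 0 := fun y hy h => hS0 (h ▸ hy)
  set W := κ • S with hW
  have g1 : ∀ y ∈ S, (#(Z + y • W) : ℝ) ≤ Λ ^ 2 * #Z := fun y hy => by
    rw [sq]; exact card_add_smul_le (hne y hy) hZ (h2 y hy) h1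
  have g2 : ∀ y ∈ S, (#(Z + (-y) • W) : ℝ) ≤ Λ ^ 2 * #Z := fun y hy => by
    rw [sq]; exact card_add_smul_le (neg_ne_zero.2 (hne y hy)) hZ (h3 y hy) h1
  have g3 : ∀ y ∈ S, ∀ y' ∈ S, (#(Z + (y * y') • W) : ℝ) ≤ Λ ^ 3 * #Z := fun y hy y' hy' => by
    rw [mul_smul, pow_succ']
    exact card_add_smul_le (hne y hy) hZ (h2 y hy) (g1 y' hy')
  have g4 : ∀ y ∈ S, ∀ y' ∈ S, (#(Z + (-y * y') • W) : ℝ) ≤ Λ ^ 3 * #Z := fun y hy y' hy' => by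
    rw [mul_smul, pow_succ']
    exact card_add_smul_le (neg_ne_zero.2 (hne y hy)) hZ (h3 y hy) (g1 y' hy')
  have hmulW : ∀ r : F, #(S + r • S) = #(W + r • W) := by
    intro r
    rw [hW, smul_comm r κ S, card_smul_add_smul hκ]
  have card4 : ∀ p q s t : F, (#({p, q, s, t} : Finset F) : ℝ) ≤ 4 := by
    intro p q s t
    exact_mod_cast card_le_four
  -- Six summands, at most four multipliers, cost `Λ²` each: `(4Λ²)⁶ = 4096 Λ¹²`. For products
  -- below, four summands at cost `Λ³` give the same power of `Λ`.
  have hshift : ∀ r ∈ quotientSet S, (#(S + (r + 1) • S) : ℝ) ≤ 4096 * Λ ^ 12 * #Z := by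
    rintro r ⟨y₁, m₁, y₂, m₂, y₃, m₃, y₄, m₄, hne', rfl⟩
    set T : Finset F := {y₃, -y₄, y₁, -y₂} with hT
    have hTW := card_nsmul_mul_le (W := W) (T := T) hZ (M := Λ ^ 2) (by
      intro t ht
      simp only [hT, mem_insert, mem_singleton] at ht
      rcases ht with rfl | rfl | rfl | rfl
      exacts [g1 _ m₃, g2 _ m₄, g1 _ m₁, g2 _ m₂]) 6
    calc (#(S + ((y₁ - y₂) / (y₃ - y₄) + 1) • S) : ℝ) ≤ #(6 • (T * W)) := by
          rw [hmulW]; exact_mod_cast card_add_smul_div_add_one_le hne'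
      _ ≤ _ := hTW
      _ ≤ (4 * Λ ^ 2) ^ 6 * #Z := by gcongr; exact card4 _ _ _ _
      _ = _ := by ring
  have hdil : ∀ r ∈ quotientSet S, ∀ y ∈ S, (#(S + (r * y) • S) : ℝ) ≤ 4096 * Λ ^ 12 * #Z := by
    rintro r ⟨y₁, m₁, y₂, m₂, y₃, m₃, y₄, m₄, hne', rfl⟩ y m
    set T : Finset F := {y₃, -y₄, y₁ * y, -y₂ * y} with hT
    have h23 : Λ ^ 2 * #Z ≤ Λ ^ 3 * #Z := by gcongr; norm_num
    have hTW := card_nsmul_mul_le (W := W) (T := T) hZ (M := Λ ^ 3) (by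
      intro t ht
      simp only [hT, mem_insert, mem_singleton] at ht
      rcases ht with rfl | rfl | rfl | rfl
      exacts [(g1 _ m₃).trans h23, (g2 _ m₄).trans h23, g3 _ m₁ _ m, g4 _ m₂ _ m]) 4
    calc (#(S + ((y₁ - y₂) / (y₃ - y₄) * y) • S) : ℝ) ≤ #(4 • (T * W)) := by
          rw [hmulW]; exact_mod_cast card_add_smul_div_mul_le hne'
      _ ≤ _ := hTW
      _ ≤ (4 * Λ ^ 3) ^ 4 * #Z := by gcongr; exact card4 _ _ _ _
      _ = 256 * (Λ ^ 12 * #Z) := by ring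
      _ ≤ 4096 * (Λ ^ 12 * #Z) := by gcongr; norm_num
      _ = _ := by ring
  have hpos : 0 ≤ 4096 * Λ ^ 12 * (#Z : ℝ) := by positivity
  by_cases hadd : ∀ r ∈ quotientSet S, r + 1 ∈ quotientSet S
  swap
  · left
    push Not at hadd
    obtain ⟨r, hr, hr'⟩ := hadd
    have h := hshift r hr
    rw [card_add_smul_of_notMem_quotientSet hS1 hr'] at h
    push_cast at h
    linarith
  by_cases hmul : ∀ r ∈ quotientSet S, ∀ y ∈ S, r * y ∈ quotientSet S
  swap
  · left
    push Not at hmul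
    obtain ⟨r, hr, y, hy, hr'⟩ := hmul
    have h := hdil r hr y hy
    rw [card_add_smul_of_notMem_quotientSet hS1 hr'] at h
    push_cast at h
    linarith
  obtain ⟨G, hG, hSG⟩ := exists_subfield_of_quotientSet_stable hS1 hadd hmul
  have hfin : (G : Set F).Finite := hG ▸ finite_quotientSet S
  rcases lt_or_ge (G : Set F).ncard (#S ^ 2) with hlt | hge
  · exact Or.inr ⟨G, hfin, hSG, hlt⟩
  · left
    rw [Set.ncard_eq_toFinset_card _ hfin] at hge
    obtain ⟨r, hr, hr'⟩ := exists_card_sq_le_two_mul_card_add_smul hge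
      (card_pos.1 (zero_lt_one.trans hS1))
    have hrG : r ∈ G := by simpa using hr
    -- The quotient set is now a field, so the shift bound applied to `r - 1` controls `S + r • S`
    -- itself.
    have hr1 : r - 1 ∈ quotientSet S := by
      rw [← hG]; exact G.sub_mem hrG G.one_mem
    have h := hshift _ hr1
    rw [sub_add_cancel] at h
    have h' : (#S : ℝ) ^ 2 ≤ 2 * #(S + r • S) := by exact_mod_cast hr'
    linarith

end Growth

/-! ### Pivoting: a structured set of multipliers inside `A`. -/

section Pivot

variable {F : Type*} [Field F] [DecidableEq F]

/-- Averaging over a pivot: if the sets `W x` support a positive proportion of a family of bipartite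
graphs, then one of them meets many of the others in a set that still supports many edges. -/
theorem exists_popular_inter {F : Type*} [DecidableEq F] (X A A' : Finset F) (H : F → F → F → Prop)
    [∀ x u w, Decidable (H x u w)] (W : F → Finset F) (hWA : ∀ x, W x ⊆ A) (hA' : A' ⊆ A)
    {δ : ℝ} (hδ : 0 < δ) (hA : A.Nonempty) (hX : X.Nonempty)
    (hH : δ * #A ^ 2 * #X ≤ ∑ x ∈ X, ∑ u ∈ A', ∑ w ∈ W x, (if H x u w then (1 : ℝ) else 0)) :
    ∃ x₁ ∈ X, δ ^ 2 / 2 * #A ^ 2 * #X ≤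
      ∑ x ∈ X.filter (fun x => δ ^ 2 / 2 * #A ≤ #(W x ∩ W x₁)), ∑ u ∈ A', ∑ w ∈ W x ∩ W x₁,
        (if H x u w then (1 : ℝ) else 0) := by
  have ha : (0 : ℝ) < #A := by exact_mod_cast hA.card_pos
  have hb : (0 : ℝ) < #X := by exact_mod_cast hX.card_pos
  have haA' : (#A' : ℝ) ≤ #A := by exact_mod_cast card_le_card hA'
  set a : ℝ := (#A : ℝ) with ha_def
  set b : ℝ := (#X : ℝ) with hb_def
  set h : F → F → F → ℝ := fun x u w => if H x u w then (1 : ℝ) else 0 with h_def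
  have h0 : ∀ x u w, 0 ≤ h x u w := by intro x u w; simp only [h]; split_ifs <;> norm_num
  have h1 : ∀ x u w, h x u w ≤ 1 := by intro x u w; simp only [h]; split_ifs <;> norm_num
  set i : F → F → ℝ := fun x w => if w ∈ W x then (1 : ℝ) else 0 with hi
  have hsumW : ∀ x (f : F → ℝ), ∑ w ∈ W x, f w = ∑ w ∈ A, i x w * f w := by
    intro x f
    simp only [hi, ite_mul, one_mul, zero_mul]
    rw [← sum_filter]
    congr 1
    ext w
    simp only [mem_filter]
    exact ⟨fun hw => ⟨hWA x hw, hw⟩, fun hw => hw.2⟩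
  have hsumWW : ∀ x x₁ (f : F → ℝ), ∑ w ∈ W x ∩ W x₁, f w = ∑ w ∈ A, i x₁ w * (i x w * f w) := by
    intro x x₁ f
    simp only [hi, ite_mul, one_mul, zero_mul]
    rw [← sum_filter, ← sum_filter, filter_filter]
    congr 1
    ext w
    simp only [mem_filter, mem_inter]
    exact ⟨fun hw => ⟨hWA x hw.1, hw.2, hw.1⟩, fun hw => ⟨hw.2.2, hw.2.1⟩⟩
  set f : F → ℝ := fun w => ∑ x ∈ X, ∑ u ∈ A', i x w * h x u w with hf
  set g : F → ℝ := fun w => ∑ x ∈ X, i x w with hg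
  have hi0 : ∀ x w, 0 ≤ i x w := by intro x w; simp only [hi]; split_ifs <;> norm_num
  have hf0 : ∀ w, 0 ≤ f w := fun w => sum_nonneg fun _ _ => sum_nonneg fun _ _ =>
    mul_nonneg (hi0 _ _) (h0 _ _ _)
  have hfg : ∀ w, f w ≤ a * g w := by
    intro w
    simp only [hf, hg, mul_sum]
    refine sum_le_sum fun x _ => ?_
    calc ∑ u ∈ A', i x w * h x u w ≤ ∑ u ∈ A', i x w * 1 :=
          sum_le_sum fun u _ => mul_le_mul_of_nonneg_left (h1 _ _ _) (hi0 _ _)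
      _ = #A' * i x w := by simp
      _ ≤ a * i x w := mul_le_mul_of_nonneg_right haA' (hi0 _ _)
  have hfsum : δ * a ^ 2 * b ≤ ∑ w ∈ A, f w := by
    refine hH.trans (le_of_eq (Eq.symm ?_))
    simp only [hf]
    rw [sum_comm]
    refine sum_congr rfl fun x _ => ?_
    rw [sum_comm]
    exact sum_congr rfl fun u _ => (hsumW x _).symm
  have hcs := sq_sum_le_card_mul_sum_sq (s := A) (f := f)
  -- `∑ f g` counts edges `(x, u, w)` together with a second index `x₁` such that `w ∈ W x ∩ W x₁`.
  -- It is bounded below by Cauchy–Schwarz for `f` and `f ≤ a g`.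
  have hN : δ ^ 2 * a ^ 2 * b ^ 2 ≤ ∑ w ∈ A, f w * g w := by
    have e1 : ∑ w ∈ A, f w ^ 2 ≤ a * ∑ w ∈ A, f w * g w := by
      rw [mul_sum]
      refine sum_le_sum fun w _ => ?_
      calc f w ^ 2 = f w * f w := sq _
        _ ≤ f w * (a * g w) := mul_le_mul_of_nonneg_left (hfg w) (hf0 w)
        _ = _ := by ring
    have e2 : (δ * a ^ 2 * b) ^ 2 ≤ (∑ w ∈ A, f w) ^ 2 := by gcongr
    have e3 : a ^ 2 * (δ ^ 2 * a ^ 2 * b ^ 2) ≤ a ^ 2 * ∑ w ∈ A, f w * g w := by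
      calc _ = (δ * a ^ 2 * b) ^ 2 := by ring
        _ ≤ a * ∑ w ∈ A, f w ^ 2 := e2.trans hcs
        _ ≤ a * (a * ∑ w ∈ A, f w * g w) := by gcongr
        _ = _ := by ring
    exact le_of_mul_le_mul_left e3 (by positivity)
  have hexp : ∑ x₁ ∈ X, ∑ x ∈ X, ∑ u ∈ A', ∑ w ∈ W x ∩ W x₁, h x u w =
      ∑ w ∈ A, f w * g w := by
    have : ∀ x₁ ∈ X, ∑ x ∈ X, ∑ u ∈ A', ∑ w ∈ W x ∩ W x₁, h x u w = ∑ w ∈ A, f w * i x₁ w := by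
      intro x₁ _
      symm
      simp only [hf, sum_mul]
      rw [sum_comm]
      refine sum_congr rfl fun x _ => ?_
      rw [sum_comm]
      refine sum_congr rfl fun u _ => ?_
      rw [hsumWW]
      exact sum_congr rfl fun w _ => by ring
    rw [sum_congr rfl this, sum_comm]
    refine sum_congr rfl fun w _ => ?_
    simp only [hg, mul_sum]
  obtain ⟨x₁, hx₁, hx₁'⟩ : ∃ x₁ ∈ X, δ ^ 2 * a ^ 2 * b ≤
      ∑ x ∈ X, ∑ u ∈ A', ∑ w ∈ W x ∩ W x₁, h x u w := by
    refine exists_le_of_sum_le hX ?_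
    rw [hexp, sum_const, nsmul_eq_mul]
    refine le_trans (le_of_eq ?_) hN
    rw [← hb_def]; ring
  refine ⟨x₁, hx₁, ?_⟩
  rw [← sum_filter_add_sum_filter_not X (fun x => δ ^ 2 / 2 * a ≤ #(W x ∩ W x₁))] at hx₁'
  have hsmall : ∑ x ∈ X.filter (fun x => ¬ δ ^ 2 / 2 * a ≤ #(W x ∩ W x₁)),
      ∑ u ∈ A', ∑ w ∈ W x ∩ W x₁, h x u w ≤ b * (δ ^ 2 / 2 * a ^ 2) := by
    calc _ ≤ ∑ x ∈ X.filter (fun x => ¬ δ ^ 2 / 2 * a ≤ #(W x ∩ W x₁)), δ ^ 2 / 2 * a ^ 2 := by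
          refine sum_le_sum fun x hx => ?_
          have hx' := (not_le.1 (mem_filter.1 hx).2).le
          calc ∑ u ∈ A', ∑ w ∈ W x ∩ W x₁, h x u w ≤ ∑ u ∈ A', ∑ w ∈ W x ∩ W x₁, (1 : ℝ) :=
                sum_le_sum fun _ _ => sum_le_sum fun _ _ => h1 _ _ _
            _ = #A' * #(W x ∩ W x₁) := by simp
            _ ≤ a * (δ ^ 2 / 2 * a) := by gcongr
            _ = _ := by ring
      _ = #(X.filter (fun x => ¬ δ ^ 2 / 2 * a ≤ #(W x ∩ W x₁))) * (δ ^ 2 / 2 * a ^ 2) := by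
          simp
      _ ≤ _ := by
          gcongr
          rw [hb_def]
          exact_mod_cast card_filter_le _ _
  linarith

/-- The bookkeeping after Ruzsa's inequality: `2²¹ = 128 · 128 · 32 · 4` and `18 = 6 + 6 + 4 + 2`.
-/
theorem le_of_mul_le_mul_of_le {δ a c p q z : ℝ} {n : ℕ} (hδ : 0 < δ) (ha : 0 < a)
    (hc : δ ^ 4 / 32 * a ≤ c) (hn : n * c ≤ p * q) (hp : p ≤ 128 / δ ^ 6 * a)
    (hq : q ≤ 128 / δ ^ 6 * a) (hz : δ ^ 2 / 4 * a ≤ z) (hq0 : 0 ≤ q) :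
    (n : ℝ) ≤ 2 ^ 21 / δ ^ 18 * z := by
  have h3 : (n : ℝ) * (δ ^ 4 / 32 * a) ≤ (2 ^ 19 / δ ^ 16 * a) * (δ ^ 4 / 32 * a) := by
    calc (n : ℝ) * (δ ^ 4 / 32 * a) ≤ n * c := by gcongr
      _ ≤ p * q := hn
      _ ≤ (128 / δ ^ 6 * a) * (128 / δ ^ 6 * a) := by gcongr
      _ = _ := by field_simp; norm_num
  calc (n : ℝ) ≤ 2 ^ 19 / δ ^ 16 * a := le_of_mul_le_mul_right h3 (by positivity)
    _ = 2 ^ 21 / δ ^ 18 * (δ ^ 2 / 4 * a) := by field_simp; norm_num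
    _ ≤ _ := by gcongr

theorem mul_le_mul_of_le {δ a z : ℝ} (hδ : 0 < δ) (hδ1 : δ ≤ 1) (ha : 0 ≤ a)
    (hz : δ ^ 2 / 4 * a ≤ z) : 128 / δ ^ 6 * a ≤ 2 ^ 21 / δ ^ 18 * z := by
  have h : δ ^ 18 ≤ δ ^ 8 := pow_le_pow_of_le_one hδ.le hδ1 (by norm_num)
  calc 128 / δ ^ 6 * a = 2 ^ 9 / δ ^ 8 * (δ ^ 2 / 4 * a) := by field_simp; ring
    _ ≤ 2 ^ 21 / δ ^ 18 * z := by
      gcongr <;> norm_num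

omit [DecidableEq F] in
-- With `w = s + t (s - u)`, this expresses the multiplier `t / x₁` as an affine function of `w`.
theorem inv_mul_add_mul_inv {s u x₁ t : F} (hsu : s - u ≠ 0) (hx₁ : x₁ ≠ 0) :
    ((s - u) * x₁)⁻¹ * (s + t * (s - u)) + -s * ((s - u) * x₁)⁻¹ = t / x₁ := by
  field_simp
  ring

/-- From a dense family of relations `(1 + x) s = x u + w` in `A` one obtains an ambient set `Z` and
a large set `Y ⊆ A`, an affine image of which acts on `Z` with small sumsets. -/
theorem exists_pivot (X A : Finset F) (H : F → F → F → Prop)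
    [∀ x u w, Decidable (H x u w)] {δ : ℝ} (hδ : 0 < δ) (hδ1 : δ ≤ 1)
    (hX : ∀ x ∈ X, x ≠ 0 ∧ 1 + x ≠ 0)
    (hrel : ∀ x ∈ X, ∀ u ∈ A, ∀ w ∈ A, H x u w → ∃ s ∈ A, s ≠ u ∧ (1 + x) * s = x * u + w)
    (hH : δ * #A ^ 2 * #X ≤ ∑ x ∈ X, ∑ u ∈ A, ∑ w ∈ A, if H x u w then (1 : ℝ) else 0)
    (hA : A.Nonempty) (hX' : X.Nonempty) :
    ∃ Z Y : Finset F, ∃ κ η κ' : F, Z.Nonempty ∧ #Z ≤ #A ∧ Y ⊆ A ∧ κ ≠ 0 ∧ κ' ≠ 0 ∧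
      δ ^ 4 / 32 * #X ≤ #Y ∧ (#(Z + κ' • Y) : ℝ) ≤ 2 ^ 21 / δ ^ 18 * #Z ∧
      ∀ w ∈ Y, κ * w + η ≠ 0 ∧ (#(Z + (κ * w + η) • Z) : ℝ) ≤ 2 ^ 21 / δ ^ 18 * #Z ∧
        (#(Z + (-(κ * w + η)) • Z) : ℝ) ≤ 2 ^ 21 / δ ^ 18 * #Z ∧
        ∃ x ∈ X, ∃ u ∈ A, H x u w := by
  have ha : (0 : ℝ) < #A := by exact_mod_cast hA.card_pos
  have hb : (0 : ℝ) < #X := by exact_mod_cast hX'.card_pos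
  obtain ⟨A', hA', W, hWA, hsum, hsmall⟩ := uniform_bsg X A H hδ (fun h => (hX 0 h).1 rfl)
    (by
      intro x hx
      refine ⟨(1 + x) • A, (card_smul_finset_of_ne_zero (hX x hx).2 A).le, ?_⟩
      intro u hu w hw h
      obtain ⟨s, hs, -, hs'⟩ := hrel x hx u hu w hw h
      exact mem_smul_finset.2 ⟨s, hs, hs'⟩) hH hA hX'
  have hA'card : δ ^ 2 / 4 * #A ≤ #A' := by
    have h1 : ∑ x ∈ X, ∑ u ∈ A', ∑ w ∈ W x, (if H x u w then (1 : ℝ) else 0) ≤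
        #X * (#A' * #A) := by
      calc _ ≤ ∑ x ∈ X, ∑ u ∈ A', (#A : ℝ) := by
            refine sum_le_sum fun x _ => sum_le_sum fun u _ => ?_
            rw [← sum_filter, sum_const, nsmul_one]
            exact_mod_cast card_le_card ((filter_subset _ _).trans (hWA x))
        _ = _ := by simp
    have h2 : (δ ^ 2 / 4 * #A) * (#A * #X) ≤ #A' * (#A * #X : ℝ) := by
      calc (δ ^ 2 / 4 * #A) * (#A * #X : ℝ) = δ ^ 2 / 4 * #A ^ 2 * #X := by ring
        _ ≤ _ := hsum.trans h1
        _ = _ := by ring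
    exact le_of_mul_le_mul_right h2 (by positivity)
  have hZpos : (0 : ℝ) < #A' := lt_of_lt_of_le (by positivity) hA'card
  obtain ⟨x₁, hx₁, hx₁'⟩ := exists_popular_inter X A A' H W hWA hA' (δ := δ ^ 2 / 4)
    (by positivity) hA hX' hsum
  have hc : (δ ^ 2 / 4) ^ 2 / 2 = δ ^ 4 / 32 := by ring
  rw [hc] at hx₁'
  set X₁ := X.filter (fun x => δ ^ 4 / 32 * #A ≤ (#(W x ∩ W x₁) : ℝ)) with hX₁
  set 𝒯 : Finset (F × F × F) := (X₁ ×ˢ A' ×ˢ A).filter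
    (fun t => t.2.2 ∈ W t.1 ∩ W x₁ ∧ H t.1 t.2.1 t.2.2) with h𝒯
  have h𝒯card : δ ^ 4 / 32 * #A ^ 2 * #X ≤ (#𝒯 : ℝ) := by
    refine hx₁'.trans (le_of_eq ?_)
    rw [h𝒯, card_filter, sum_product]
    push_cast
    refine sum_congr rfl fun x _ => ?_
    rw [sum_product]
    refine sum_congr rfl fun u _ => ?_
    rw [← sum_filter, ← sum_filter]
    congr 1
    ext w
    simp only [mem_filter]
    exact ⟨fun h => ⟨hWA x (mem_inter.1 h.1).1, h⟩, fun h => h.2⟩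
  have hmem : ∀ t ∈ 𝒯, t.1 ∈ X ∧ δ ^ 4 / 32 * #A ≤ (#(W t.1 ∩ W x₁) : ℝ) ∧ t.2.1 ∈ A ∧ t.2.2 ∈ A ∧
      t.2.2 ∈ W x₁ ∧ H t.1 t.2.1 t.2.2 ∧ t.2.1 ∈ A' := by
    intro t ht
    obtain ⟨ht1, ht2, ht3⟩ := mem_filter.1 ht
    obtain ⟨h1, h23⟩ := mem_product.1 ht1
    obtain ⟨h2, h3⟩ := mem_product.1 h23
    obtain ⟨h4, h5⟩ := mem_filter.1 h1
    exact ⟨h4, h5, hA' h2, h3, (mem_inter.1 ht2).2, ht3, h2⟩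
  -- With `u` and `s` frozen, the relation becomes `w = s + x (s - u)`. As `s ≠ u`, distinct `x`
  -- give distinct `w`, and all these `w` lie in `W x₁`.
  obtain ⟨⟨u, s⟩, -, hus⟩ := exists_le_card_fiber_of_nsmul_le_card_of_maps_to
    (s := 𝒯) (t := A ×ˢ A) (f := fun t => (t.2.1, (t.1 * t.2.1 + t.2.2) / (1 + t.1)))
    (b := δ ^ 4 / 32 * #X) (by
      intro t ht
      obtain ⟨h1, -, h2, h3, -, h4, -⟩ := hmem t ht
      obtain ⟨s, hs, -, hs'⟩ := hrel _ h1 _ h2 _ h3 h4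
      refine mem_product.2 ⟨h2, ?_⟩
      rwa [← hs', mul_div_cancel_left₀ _ (hX _ h1).2]) (hA.product hA) (by
      rw [nsmul_eq_mul, card_product]
      push_cast
      refine le_trans (le_of_eq ?_) h𝒯card
      ring)
  set 𝒯' := 𝒯.filter fun t => (t.2.1, (t.1 * t.2.1 + t.2.2) / (1 + t.1)) = (u, s) with h𝒯'
  have hX1pos : (0 : ℝ) < δ ^ 4 / 32 * #X := by positivity
  have hmem' : ∀ t ∈ 𝒯', t ∈ 𝒯 ∧ t.2.1 = u ∧ s ≠ u ∧ t.2.2 = s + t.1 * (s - u) := by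
    intro t ht
    obtain ⟨ht1, ht2⟩ := mem_filter.1 ht
    simp only [Prod.mk.injEq] at ht2
    obtain ⟨h1, -, h2, h3, -, h4, -⟩ := hmem t ht1
    obtain ⟨s', hs, hsu, hs'⟩ := hrel _ h1 _ h2 _ h3 h4
    have hss' : s' = s := by
      rw [← ht2.2, ← hs', mul_div_cancel_left₀ _ (hX _ h1).2]
    subst hss'
    refine ⟨ht1, ht2.1, ht2.1 ▸ hsu, ?_⟩
    rw [← ht2.1]
    linear_combination -hs'
  have hx₁0 : x₁ ≠ 0 := (hX x₁ hx₁).1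
  obtain ⟨t₀, ht₀⟩ : 𝒯'.Nonempty := by
    rw [← card_pos]
    exact_mod_cast hX1pos.trans_le hus
  have hsu : s - u ≠ 0 := sub_ne_zero.2 (hmem' t₀ ht₀).2.2.1
  set Y := 𝒯'.image fun t => t.2.2 with hY
  have hYcard : #Y = #𝒯' := by
    refine card_image_of_injOn ?_
    intro t ht t' ht' h
    obtain ⟨-, h1, -, h2⟩ := hmem' t ht
    obtain ⟨-, h1', -, h2'⟩ := hmem' t' ht'
    simp only at h
    have h3 : t.1 = t'.1 := by
      rw [h2, h2'] at h
      exact mul_right_cancel₀ hsu (add_left_cancel h)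
    exact Prod.ext h3 (Prod.ext (h1.trans h1'.symm) h)
  have hYW : Y ⊆ W x₁ := by
    intro w hw
    obtain ⟨t, ht, rfl⟩ := mem_image.1 hw
    exact (hmem t (hmem' t ht).1).2.2.2.2.1
  have hsm : ∀ x ∈ X, (#(x • A' + W x) : ℝ) ≤ 128 / δ ^ 6 * #A := hsmall
  -- The triangle inequality passes through `W x ∩ W x₁`, whose sums with both `x • A'` and `x₁ •
  -- A'` are small.
  have hpair : ∀ x ∈ X, δ ^ 4 / 32 * #A ≤ (#(W x ∩ W x₁) : ℝ) → ∀ n : ℕ,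
      n * #(W x ∩ W x₁) ≤ #(x₁ • A' + W x ∩ W x₁) * #(x • A' + W x ∩ W x₁) →
      (n : ℝ) ≤ 2 ^ 21 / δ ^ 18 * #A' := by
    intro x hx hx' n hn
    have h1 : (#(x₁ • A' + W x ∩ W x₁) : ℝ) ≤ 128 / δ ^ 6 * #A :=
      (Nat.cast_le.2 (card_le_card (add_subset_add_left inter_subset_right))).trans (hsm x₁ hx₁)
    have h2 : (#(x • A' + W x ∩ W x₁) : ℝ) ≤ 128 / δ ^ 6 * #A :=
      (Nat.cast_le.2 (card_le_card (add_subset_add_left inter_subset_left))).trans (hsm x hx)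
    exact le_of_mul_le_mul_of_le hδ ha hx' (by exact_mod_cast hn) h1 h2 hA'card
      (Nat.cast_nonneg _)
  have hκ : ∀ t ∈ 𝒯', ((s - u) * x₁)⁻¹ * t.2.2 + -s * ((s - u) * x₁)⁻¹ = t.1 / x₁ := by
    intro t ht
    rw [(hmem' t ht).2.2.2]
    exact inv_mul_add_mul_inv hsu hx₁0
  refine ⟨A', Y, ((s - u) * x₁)⁻¹, -s * ((s - u) * x₁)⁻¹, x₁⁻¹, card_pos.1 (by exact_mod_cast hZpos),
    card_le_card hA', hYW.trans (hWA x₁), inv_ne_zero (mul_ne_zero hsu hx₁0), inv_ne_zero hx₁0,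
    by rwa [hYcard], ?_, ?_⟩
  · have h1 : #(A' + x₁⁻¹ • Y) = #(x₁ • A' + Y) := by
      rw [← card_smul_add_smul hx₁0, smul_smul, mul_inv_cancel₀ hx₁0, one_smul]
    rw [h1]
    calc (#(x₁ • A' + Y) : ℝ) ≤ #(x₁ • A' + W x₁) := by
          exact_mod_cast card_le_card (add_subset_add_left hYW)
      _ ≤ 128 / δ ^ 6 * #A := hsm x₁ hx₁
      _ ≤ 2 ^ 21 / δ ^ 18 * #A' := mul_le_mul_of_le hδ hδ1 ha.le hA'card
  · intro w hw
    obtain ⟨t, ht, rfl⟩ := mem_image.1 hw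
    obtain ⟨h1, h2, h3, h4, h5, h6, -⟩ := hmem t (hmem' t ht).1
    rw [hκ t ht]
    have hz : ∀ c : F, #(A' + (c / x₁) • A') = #(x₁ • A' + c • A') := by
      intro c
      rw [← card_smul_add_smul hx₁0, smul_smul, mul_div_cancel₀ _ hx₁0]
    refine ⟨div_ne_zero (hX _ h1).1 hx₁0, ?_, ?_, t.1, h1, t.2.1, h3, h6⟩
    · rw [hz]
      refine hpair t.1 h1 h2 _ ?_
      have := ruzsa_triangle_inequality_add_add_add (x₁ • A') (W t.1 ∩ W x₁) (t.1 • A')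
      rwa [add_comm (W t.1 ∩ W x₁)] at this
    · rw [← neg_div, hz]
      refine hpair t.1 h1 h2 _ ?_
      have := ruzsa_triangle_inequality_sub_add_add (x₁ • A') (W t.1 ∩ W x₁) (t.1 • A')
      rwa [sub_eq_add_neg, ← neg_smul_finset] at this

/-- The combinatorial core: a dense family of relations `(1 + x) s = x u + w` in `A`, together with
a dense incidence relation `E` between `A` and `V`, produces a large subset `Y` of a fibre of `E`
which is either small compared with `|A| ^ (1/2)` or affinely contained in a small subfield. -/
theorem exists_fiber_subset (X A V : Finset F) (H : F → F → F → Prop)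
    [∀ x u w, Decidable (H x u w)] (E : F → F → Prop) [∀ u v, Decidable (E u v)]
    {δ ρ : ℝ} (hδ : 0 < δ) (hδ1 : δ ≤ 1)
    (hX : ∀ x ∈ X, x ≠ 0 ∧ 1 + x ≠ 0)
    (hrel : ∀ x ∈ X, ∀ u ∈ A, ∀ w ∈ A, H x u w → ∃ s ∈ A, s ≠ u ∧ (1 + x) * s = x * u + w)
    (hH : δ * #A ^ 2 * #X ≤ ∑ x ∈ X, ∑ u ∈ A, ∑ w ∈ A, if H x u w then (1 : ℝ) else 0)
    (hE : ∀ x ∈ X, ∀ u ∈ A, ∀ w ∈ A, H x u w → ρ * #V ≤ #(V.filter fun v => E w v))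
    (hA : A.Nonempty) (hX' : X.Nonempty) (hV : V.Nonempty) :
    ∃ v ∈ V, ∃ Y ⊆ A, (∀ w ∈ Y, E w v) ∧ ρ * (δ ^ 4 / 32 * #X) ≤ #Y ∧
      ((#Y : ℝ) ^ 2 ≤ 8192 * (2 ^ 21 / δ ^ 18) ^ 12 * #A ∨
        ∃ G : Subfield F, ∃ α β : F, (G : Set F).Finite ∧
          ↑Y ⊆ (fun g : F => α * g + β) '' (G : Set F) ∧ (G : Set F).ncard < #Y ^ 2) := by
  obtain ⟨Z, Y, κ, η, κ', hZ, hZA, hYA, hκ, hκ', hYcard, hYZ, hY⟩ :=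
    exists_pivot X A H hδ hδ1 hX hrel hH hA hX'
  have hz : (0 : ℝ) < #Z := by exact_mod_cast hZ.card_pos
  have hv : (0 : ℝ) < #V := by exact_mod_cast hV.card_pos
  -- Double counting of `E` on `Y × V`: each `w ∈ Y` occurs in an edge of `H`, hence is related to
  -- at least `ρ|V|` elements of `V`.
  obtain ⟨v, hvV, hvY⟩ : ∃ v ∈ V, ρ * #Y ≤ (#(Y.filter fun w => E w v) : ℝ) := by
    refine exists_le_of_sum_le hV ?_
    have h1 : ∑ v ∈ V, (#(Y.filter fun w => E w v) : ℝ) =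
        ∑ w ∈ Y, (#(V.filter fun v => E w v) : ℝ) := by
      simp only [card_filter]
      push_cast
      exact sum_comm
    rw [h1]
    calc ∑ v ∈ V, ρ * #Y = ∑ w ∈ Y, ρ * #V := by simp; ring
      _ ≤ _ := by
        refine sum_le_sum fun w hw => ?_
        obtain ⟨-, -, -, x, hx, u, hu, h⟩ := hY w hw
        exact hE x hx u hu w (hYA hw) h
  set Y' := Y.filter fun w => E w v with hY'
  have hY'Y : Y' ⊆ Y := filter_subset _ _
  have hΛ : (1 : ℝ) ≤ 2 ^ 21 / δ ^ 18 := by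
    rw [le_div_iff₀ (by positivity), one_mul]
    exact (pow_le_one₀ hδ.le hδ1).trans (by norm_num)
  set S := Y'.image fun w => κ * w + η with hS
  have hScard : #S = #Y' := card_image_of_injective _ fun x y h =>
    mul_left_cancel₀ hκ (add_right_cancel h)
  have hZS : (#(Z + (κ' / κ) • S) : ℝ) ≤ 2 ^ 21 / δ ^ 18 * #Z := by
    refine le_trans (Nat.cast_le.2 ?_) hYZ
    rw [← card_add_singleton (Z + κ' • Y) (κ' / κ * η)]
    refine card_le_card fun x hx => ?_
    obtain ⟨z, hz, t, ht, rfl⟩ := mem_add.1 hx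
    obtain ⟨t', ht', rfl⟩ := mem_smul_finset.1 ht
    obtain ⟨w, hw, rfl⟩ := mem_image.1 ht'
    have : z + (κ' / κ) • (κ * w + η) = z + κ' • w + κ' / κ * η := by
      simp only [smul_eq_mul]
      field_simp
      ring
    rw [this]
    exact add_mem_add (add_mem_add hz (smul_mem_smul_finset (hY'Y hw))) (mem_singleton_self _)
  have hSY : ∀ y ∈ S, ∃ w ∈ Y, κ * w + η = y := by
    intro y hy
    obtain ⟨w, hw, rfl⟩ := mem_image.1 hy
    exact ⟨w, hY'Y hw, rfl⟩
  refine ⟨v, hvV, Y', hY'Y.trans hYA, fun w hw => (mem_filter.1 hw).2, ?_, ?_⟩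
  · rcases le_or_gt 0 ρ with hρ | hρ
    · exact (mul_le_mul_of_nonneg_left hYcard hρ).trans hvY
    · exact (mul_nonpos_of_nonpos_of_nonneg hρ.le (by positivity)).trans (Nat.cast_nonneg _)
  rcases card_sq_le_or_exists_subfield hZ (S := S) (κ := κ' / κ) (Λ := 2 ^ 21 / δ ^ 18)
    (fun h0 => by
      obtain ⟨w, hw, hw'⟩ := hSY 0 h0
      exact (hY w hw).1 hw') (div_ne_zero hκ' hκ) hΛ hZS
    (fun y hy => by
      obtain ⟨w, hw, rfl⟩ := hSY y hy
      exact (hY w hw).2.1)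
    (fun y hy => by
      obtain ⟨w, hw, rfl⟩ := hSY y hy
      exact (hY w hw).2.2.1) with h | ⟨G, hG, hSG, hGc⟩
  · left
    rw [hScard] at h
    refine h.trans ?_
    gcongr
  · right
    refine ⟨G, κ⁻¹, -(κ⁻¹ * η), hG, ?_, by rwa [hScard] at hGc⟩
    intro w hw
    refine ⟨κ * w + η, hSG (mem_coe.2 (mem_image_of_mem _ hw)), ?_⟩
    simp only
    field_simp
    ring

end Pivot

/-! ### Collinear triples in a projective grid. -/

section Geometry

variable {F : Type*} [Field F]

theorem eq_of_mem_determinedLines {P : Set (F × F)} {l : AffineSubspace F (F × F)}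
    (hl : l ∈ determinedLines P) {p q : F × F} (hp : p ∈ l) (hq : q ∈ l) (hpq : p ≠ q) :
    l = line[F, p, q] := by
  obtain ⟨p', -, q', -, -, rfl⟩ := hl
  exact (affineSpan_pair_eq_of_mem_of_mem_of_ne hp hq hpq).symm

theorem mul_sub_eq_of_mem_determinedLines {P : Set (F × F)} {l : AffineSubspace F (F × F)}
    (hl : l ∈ determinedLines P) {p₁ p₂ p₃ : F × F} (h₁ : p₁ ∈ l) (h₂ : p₂ ∈ l) (h₃ : p₃ ∈ l) :
    (p₂.1 - p₁.1) * (p₃.2 - p₁.2) = (p₃.1 - p₁.1) * (p₂.2 - p₁.2) := by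
  obtain ⟨p, -, q, -, -, rfl⟩ := hl
  rw [mem_affineSpan_pair_iff_exists_lineMap_eq] at h₁ h₂ h₃
  obtain ⟨r₁, rfl⟩ := h₁
  obtain ⟨r₂, rfl⟩ := h₂
  obtain ⟨r₃, rfl⟩ := h₃
  simp [AffineMap.lineMap_apply]
  ring

/-- In the coordinates `(u, y)` of the point `(u y, y)`: collinear triples of points of `R` whose
first and third points are not on a line through the origin, on three horizontal lines. -/
noncomputable def properTriples [DecidableEq F] (R : Finset (F × F)) :
    Finset ((F × F) × (F × F) × (F × F)) :=
  (R ×ˢ R ×ˢ R).filter fun t => t.1.2 ≠ t.2.1.2 ∧ t.1.2 ≠ t.2.2.2 ∧ t.2.1.2 ≠ t.2.2.2 ∧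
    t.1.1 ≠ t.2.2.1 ∧ (t.2.1.1 * t.2.1.2 - t.1.1 * t.1.2) * (t.2.2.2 - t.1.2) =
      (t.2.2.1 * t.2.2.2 - t.1.1 * t.1.2) * (t.2.1.2 - t.1.2)

/-- Among distinct collinear points two equal heights put all three on one horizontal line, and `u₁
= u₃` puts all three on one line through the origin, because heights are nonzero. So an improper
triple has coinciding points or lies on such a line. -/
theorem card_collinear_le [DecidableEq F] {R : Finset (F × F)} {U B : Finset F} (hR : R ⊆ U ×ˢ B)
    (hB : (0 : F) ∉ B) :
    #((R ×ˢ R ×ˢ R).filter fun t => (t.2.1.1 * t.2.1.2 - t.1.1 * t.1.2) * (t.2.2.2 - t.1.2) =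
      (t.2.2.1 * t.2.2.2 - t.1.1 * t.1.2) * (t.2.1.2 - t.1.2)) ≤
    #(properTriples R) + 3 * (#U * #B) ^ 2 + #B * #U ^ 3 + #U * #B ^ 3 := by
  have hRc : #R ≤ #U * #B := by
    rw [← card_product]; exact card_le_card hR
  have hRR : ∀ f : (F × F) × (F × F) → (F × F) × (F × F) × (F × F),
      #((R ×ˢ R).image f) ≤ (#U * #B) ^ 2 := by
    intro f
    refine card_image_le.trans ?_
    rw [card_product, ← sq]
    gcongr
  set D₁ := (R ×ˢ R).image fun t => (t.1, t.1, t.2) with hD₁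
  set D₂ := (R ×ˢ R).image fun t => (t.1, t.2, t.1) with hD₂
  set D₃ := (R ×ˢ R).image fun t => (t.1, t.2, t.2) with hD₃
  set D₄ := (B ×ˢ U ×ˢ U ×ˢ U).image fun t => ((t.2.1, t.1), (t.2.2.1, t.1), (t.2.2.2, t.1)) with hD₄
  set D₅ := (U ×ˢ B ×ˢ B ×ˢ B).image fun t => ((t.1, t.2.1), (t.1, t.2.2.1), (t.1, t.2.2.2)) with hD₅
  have h₄ : #D₄ ≤ #B * #U ^ 3 := by
    refine card_image_le.trans (le_of_eq ?_)
    simp only [card_product]; ring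
  have h₅ : #D₅ ≤ #U * #B ^ 3 := by
    refine card_image_le.trans (le_of_eq ?_)
    simp only [card_product]; ring
  have hsub : ((R ×ˢ R ×ˢ R).filter fun t =>
      (t.2.1.1 * t.2.1.2 - t.1.1 * t.1.2) * (t.2.2.2 - t.1.2) =
      (t.2.2.1 * t.2.2.2 - t.1.1 * t.1.2) * (t.2.1.2 - t.1.2)) ⊆
      properTriples R ∪ D₁ ∪ D₂ ∪ D₃ ∪ D₄ ∪ D₅ := by
    rintro ⟨⟨u₁, y₁⟩, ⟨u₂, y₂⟩, ⟨u₃, y₃⟩⟩ ht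
    obtain ⟨hm, hcol⟩ := mem_filter.1 ht
    obtain ⟨hm₁, hm'⟩ := mem_product.1 hm
    obtain ⟨hm₂, hm₃⟩ := mem_product.1 hm'
    simp only at hcol hm₁ hm₂ hm₃
    obtain ⟨hu₁, hy₁⟩ := mem_product.1 (hR hm₁)
    obtain ⟨hu₂, hy₂⟩ := mem_product.1 (hR hm₂)
    obtain ⟨hu₃, hy₃⟩ := mem_product.1 (hR hm₃)
    simp only at hu₁ hy₁ hu₂ hy₂ hu₃ hy₃
    have n₁ : y₁ ≠ 0 := fun h => hB (h ▸ hy₁)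
    have n₂ : y₂ ≠ 0 := fun h => hB (h ▸ hy₂)
    have n₃ : y₃ ≠ 0 := fun h => hB (h ▸ hy₃)
    have case₄ : y₂ = y₁ → y₃ = y₁ →
        ((u₁, y₁), (u₂, y₂), (u₃, y₃)) ∈ properTriples R ∪ D₁ ∪ D₂ ∪ D₃ ∪ D₄ ∪ D₅ := by
      rintro rfl rfl
      refine mem_union_left _ (mem_union_right _ (mem_image.2 ⟨(y₃, u₁, u₂, u₃), ?_, rfl⟩))
      simp [*]
    by_cases e₁₂ : (u₁, y₁) = (u₂, y₂)
    · refine mem_union_left _ (mem_union_left _ (mem_union_left _ (mem_union_left _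
        (mem_union_right _ (mem_image.2 ⟨((u₁, y₁), (u₃, y₃)), mem_product.2 ⟨hm₁, hm₃⟩, ?_⟩)))))
      rw [← e₁₂]
    by_cases e₁₃ : (u₁, y₁) = (u₃, y₃)
    · refine mem_union_left _ (mem_union_left _ (mem_union_left _
        (mem_union_right _ (mem_image.2 ⟨((u₁, y₁), (u₂, y₂)), mem_product.2 ⟨hm₁, hm₂⟩, ?_⟩))))
      rw [← e₁₃]
    by_cases e₂₃ : (u₂, y₂) = (u₃, y₃)
    · refine mem_union_left _ (mem_union_left _
        (mem_union_right _ (mem_image.2 ⟨((u₁, y₁), (u₂, y₂)), mem_product.2 ⟨hm₁, hm₂⟩, ?_⟩)))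
      rw [← e₂₃]
    by_cases f₁₂ : y₂ = y₁
    · refine case₄ f₁₂ ?_
      subst f₁₂
      have : u₂ - u₁ ≠ 0 := fun h => e₁₂ (by rw [sub_eq_zero.1 h])
      have h0 : (u₂ - u₁) * y₂ * (y₃ - y₂) = 0 := by linear_combination hcol
      exact sub_eq_zero.1 ((mul_eq_zero.1 h0).resolve_left (mul_ne_zero this n₂))
    by_cases f₁₃ : y₃ = y₁
    · refine case₄ ?_ f₁₃
      subst f₁₃
      have : u₃ - u₁ ≠ 0 := fun h => e₁₃ (by rw [sub_eq_zero.1 h])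
      have h0 : (u₃ - u₁) * y₃ * (y₂ - y₃) = 0 := by linear_combination -hcol
      exact sub_eq_zero.1 ((mul_eq_zero.1 h0).resolve_left (mul_ne_zero this n₃))
    by_cases f₂₃ : y₂ = y₃
    · subst f₂₃
      have : u₂ - u₃ ≠ 0 := fun h => e₂₃ (by rw [sub_eq_zero.1 h])
      have h0 : (u₂ - u₃) * y₂ * (y₂ - y₁) = 0 := by linear_combination hcol
      exact absurd (sub_eq_zero.1 ((mul_eq_zero.1 h0).resolve_left (mul_ne_zero this n₂))) f₁₂
    by_cases g₁₃ : u₁ = u₃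
    · subst g₁₃
      have h0 : (u₂ - u₁) * y₂ * (y₃ - y₁) = 0 := by linear_combination hcol
      have h2 : u₂ = u₁ := by
        rcases mul_eq_zero.1 h0 with h | h
        · exact sub_eq_zero.1 ((mul_eq_zero.1 h).resolve_right n₂)
        · exact absurd (sub_eq_zero.1 h) f₁₃
      subst h2
      refine mem_union_right _ (mem_image.2 ⟨(u₂, y₁, y₂, y₃), ?_, rfl⟩)
      simp [*]
    · refine mem_union_left _ (mem_union_left _ (mem_union_left _ (mem_union_left _
        (mem_union_left _ (mem_filter.2 ⟨hm, ?_⟩)))))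
      exact ⟨fun h => f₁₂ h.symm, fun h => f₁₃ h.symm, f₂₃, g₁₃, hcol⟩
  refine (card_le_card hsub).trans ?_
  have c₁ := card_union_le (properTriples R ∪ D₁ ∪ D₂ ∪ D₃ ∪ D₄) D₅
  have c₂ := card_union_le (properTriples R ∪ D₁ ∪ D₂ ∪ D₃) D₄
  have c₃ := card_union_le (properTriples R ∪ D₁ ∪ D₂) D₃
  have c₄ := card_union_le (properTriples R ∪ D₁) D₂
  have c₅ := card_union_le (properTriples R) D₁
  have b₁ := hRR fun t => (t.1, t.1, t.2)
  have b₂ := hRR fun t => (t.1, t.2, t.1)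
  have b₃ := hRR fun t => (t.1, t.2, t.2)
  rw [← hD₁] at b₁
  rw [← hD₂] at b₂
  rw [← hD₃] at b₃
  omega

/-- The collinear triples of a subset of a projective grid. -/
theorem collinearTuples_le [DecidableEq F] {R : Finset (F × F)} {U B : Finset F} (hR : R ⊆ U ×ˢ B)
    (hB : (0 : F) ∉ B) {P : Set (F × F)} (hP : ∀ p ∈ P, (p.1 / p.2, p.2) ∈ R) :
    collinearTuples 3 P (determinedLines P) ≤
      #(properTriples R) + 4 * (#U * #B) ^ 2 + #B * #U ^ 3 + #U * #B ^ 3 := by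
  have hne : ∀ p ∈ P, p.2 ≠ 0 := fun p hp h => hB (h ▸ (mem_product.1 (hR (hP p hp))).2)
  set c : F × F → F × F := fun p => (p.1 / p.2, p.2) with hc
  have hcinj : Set.InjOn c P := by
    intro p hp q hq h
    simp only [hc, Prod.mk.injEq] at h
    obtain ⟨h1, h2⟩ := h
    refine Prod.ext ?_ h2
    rw [← h2] at h1
    exact (div_left_inj' (hne p hp)).1 h1
  have hRc : #R ≤ #U * #B := by
    rw [← card_product]; exact card_le_card hR
  set 𝒯 := {t : (Fin 3 → F × F) × AffineSubspace F (F × F) |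
    (∀ i, t.1 i ∈ P) ∧ t.2 ∈ determinedLines P ∧ ∀ i, t.1 i ∈ t.2} with h𝒯
  set 𝒟 := {t ∈ 𝒯 | t.1 0 = t.1 1 ∧ t.1 0 = t.1 2} with h𝒟
  set 𝒩 := {t ∈ 𝒯 | ¬ (t.1 0 = t.1 1 ∧ t.1 0 = t.1 2)} with h𝒩
  have hsplit : 𝒯 = 𝒟 ∪ 𝒩 := by
    ext t
    simp only [h𝒟, h𝒩, Set.mem_union, Set.mem_ofPred_eq]
    tauto
  have hPfin : P.Finite := Set.Finite.of_injOn (fun p hp => hP p hp) hcinj R.finite_toSet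
  have hPcard : P.ncard ≤ #U * #B := by
    refine le_trans ?_ hRc
    rw [← Set.ncard_coe_finset]
    exact Set.ncard_le_ncard_of_injOn c (fun p hp => hP p hp) hcinj R.finite_toSet
  -- A constant triple does not determine its line; a second point of `P` on the line does. This
  -- gives the fourth copy of `(#U * #B) ^ 2`.
  have h𝒟card : 𝒟.ncard ≤ (#U * #B) ^ 2 := by
    have hsub : 𝒟 ⊆ (fun pq : (F × F) × (F × F) =>
        ((fun _ : Fin 3 => pq.1), line[F, pq.1, pq.2])) '' (P ×ˢ P) := by
      rintro ⟨t, l⟩ ⟨⟨h1, h2, h3⟩, h4, h5⟩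
      simp only at h1 h2 h3 h4 h5
      have ht : t = fun _ => t 0 := by
        funext i
        fin_cases i
        exacts [rfl, h4.symm, h5.symm]
      obtain ⟨p, hp, q, hq, hpq, hl⟩ := id h2
      have : ∃ q' ∈ P, q' ∈ l ∧ t 0 ≠ q' := by
        by_cases h : t 0 = p
        · exact ⟨q, hq, hl ▸ right_mem_affineSpan_pair _ _ _, h ▸ hpq⟩
        · exact ⟨p, hp, hl ▸ left_mem_affineSpan_pair _ _ _, h⟩
      obtain ⟨q', hq', hq'l, hne'⟩ := this
      refine ⟨(t 0, q'), ⟨h1 0, hq'⟩, ?_⟩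
      exact Prod.ext ht.symm (eq_of_mem_determinedLines h2 (h3 0) hq'l hne').symm
    calc 𝒟.ncard ≤ _ := Set.ncard_le_ncard hsub ((hPfin.prod hPfin).image _)
      _ ≤ (P ×ˢ P).ncard := Set.ncard_image_le (hPfin.prod hPfin)
      _ = P.ncard * P.ncard := Set.ncard_prod
      _ ≤ _ := by rw [sq]; gcongr
  have h𝒩card := card_collinear_le hR hB
  set 𝒞 := (R ×ˢ R ×ˢ R).filter fun t =>
    (t.2.1.1 * t.2.1.2 - t.1.1 * t.1.2) * (t.2.2.2 - t.1.2) =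
      (t.2.2.1 * t.2.2.2 - t.1.1 * t.1.2) * (t.2.1.2 - t.1.2) with h𝒞
  have h𝒩𝒞 : 𝒩.ncard ≤ #𝒞 := by
    rw [← Set.ncard_coe_finset]
    refine Set.ncard_le_ncard_of_injOn (fun t => (c (t.1 0), c (t.1 1), c (t.1 2))) ?_ ?_
      𝒞.finite_toSet
    · rintro ⟨t, l⟩ ⟨⟨h1, h2, h3⟩, -⟩
      simp only at h1 h2 h3
      refine mem_coe.2 (mem_filter.2 ⟨mem_product.2 ⟨hP _ (h1 0), mem_product.2
        ⟨hP _ (h1 1), hP _ (h1 2)⟩⟩, ?_⟩)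
      simp only [hc, div_mul_cancel₀ _ (hne _ (h1 _))]
      exact mul_sub_eq_of_mem_determinedLines h2 (h3 0) (h3 1) (h3 2)
    · rintro ⟨t, l⟩ ⟨⟨h1, h2, h3⟩, h4⟩ ⟨t', l'⟩ ⟨⟨h1', h2', h3'⟩, h4'⟩ h
      simp only [Prod.mk.injEq] at h h1 h2 h3 h4 h1' h2' h3' h4'
      have e : t = t' := by
        funext i
        fin_cases i
        exacts [hcinj (h1 0) (h1' 0) h.1, hcinj (h1 1) (h1' 1) h.2.1, hcinj (h1 2) (h1' 2) h.2.2]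
      subst e
      refine Prod.ext rfl ?_
      by_cases h01 : t 0 = t 1
      · have h02 : t 0 ≠ t 2 := fun h => h4 ⟨h01, h⟩
        exact (eq_of_mem_determinedLines h2 (h3 0) (h3 2) h02).trans
          (eq_of_mem_determinedLines h2' (h3' 0) (h3' 2) h02).symm
      · exact (eq_of_mem_determinedLines h2 (h3 0) (h3 1) h01).trans
          (eq_of_mem_determinedLines h2' (h3' 0) (h3' 1) h01).symm
  have : collinearTuples 3 P (determinedLines P) ≤ 𝒟.ncard + 𝒩.ncard := by
    rw [collinearTuples, ← h𝒯, hsplit]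
    exact Set.ncard_union_le _ _
  omega

end Geometry

/-! ### From proper triples to a large subset of one row. -/

section Selection

variable {F : Type*} [Field F] [DecidableEq F]

theorem mem_properTriples {R : Finset (F × F)} {t : (F × F) × (F × F) × (F × F)} :
    t ∈ properTriples R ↔ (t.1 ∈ R ∧ t.2.1 ∈ R ∧ t.2.2 ∈ R) ∧ t.1.2 ≠ t.2.1.2 ∧
      t.1.2 ≠ t.2.2.2 ∧ t.2.1.2 ≠ t.2.2.2 ∧
      t.1.1 ≠ t.2.2.1 ∧ (t.2.1.1 * t.2.1.2 - t.1.1 * t.1.2) * (t.2.2.2 - t.1.2) =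
        (t.2.2.1 * t.2.2.2 - t.1.1 * t.1.2) * (t.2.1.2 - t.1.2) := by
  simp only [properTriples, mem_filter, mem_product]

/-- Two points and the height of the third point determine a proper triple. -/
theorem properTriples_third_eq {R : Finset (F × F)} {t t' : (F × F) × (F × F) × (F × F)}
    (ht : t ∈ properTriples R) (ht' : t' ∈ properTriples R) (h0 : t.2.2.2 ≠ 0) (h₁ : t.1 = t'.1)
    (h₂ : t.2.1 = t'.2.1) (h₃ : t.2.2.2 = t'.2.2.2) : t = t' := by
  obtain ⟨p₁, p₂, u₃, y₃⟩ := t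
  obtain ⟨p₁', p₂', u₃', y₃'⟩ := t'
  simp only at h₁ h₂ h₃ h0
  subst h₁ h₂ h₃
  obtain ⟨-, h12, -, -, -, e⟩ := mem_properTriples.1 ht
  obtain ⟨-, -, -, -, -, e'⟩ := mem_properTriples.1 ht'
  simp only at e e' h12
  have h : u₃ * y₃ - p₁.1 * p₁.2 = u₃' * y₃ - p₁.1 * p₁.2 :=
    mul_right_cancel₀ (sub_ne_zero.2 h12.symm) (e.symm.trans e')
  rw [mul_right_cancel₀ h0 (sub_left_injective h)]

/-- The number of points of `R` on the line through the origin with parameter `u`. -/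
def columnDegree (R : Finset (F × F)) (B : Finset F) (u : F) : ℕ := #(B.filter fun y => (u, y) ∈ R)

/-- Poor columns hold at most `ρ|U||B|` possible middle points in all. There are at most `|U||B|`
first points and `|B|` third heights, and these data determine the triple. -/
theorem card_poor_triples_le {R : Finset (F × F)} {U B : Finset F} (hR : R ⊆ U ×ˢ B)
    (hB : (0 : F) ∉ B) {ρ : ℝ} (hρ : 0 ≤ ρ) :
    (#((properTriples R).filter fun t => ¬ ρ * #B ≤ columnDegree R B t.2.1.1) : ℝ) ≤
      ρ * #U ^ 2 * #B ^ 3 := by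
  set Q := (properTriples R).filter fun t => ¬ ρ * #B ≤ (columnDegree R B t.2.1.1 : ℝ) with hQ
  set R' := R.filter fun p => ¬ ρ * #B ≤ (columnDegree R B p.1 : ℝ) with hR'
  have hRc : #R ≤ #U * #B := by
    rw [← card_product]; exact card_le_card hR
  have hR'c : (#R' : ℝ) ≤ #U * (ρ * #B) := by
    have h1 : #R' = ∑ u ∈ U, #(R'.filter fun p => p.1 = u) :=
      card_eq_sum_card_fiberwise fun p hp => (mem_product.1 (hR (mem_filter.1 hp).1)).1
    rw [h1]
    push_cast
    calc ∑ u ∈ U, (#(R'.filter fun p => p.1 = u) : ℝ) ≤ ∑ u ∈ U, ρ * #B := by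
          refine sum_le_sum fun u _ => ?_
          rcases (R'.filter fun p => p.1 = u).eq_empty_or_nonempty with h | ⟨p, hp⟩
          · rw [h]; simp; positivity
          · obtain ⟨hp1, rfl⟩ := mem_filter.1 hp
            refine le_trans ?_ (not_le.1 (mem_filter.1 hp1).2).le
            rw [columnDegree]
            norm_cast
            refine card_le_card_of_injOn Prod.snd ?_ ?_
            · rintro ⟨u', y⟩ hq
              obtain ⟨hq1, hq2⟩ := mem_filter.1 (mem_coe.1 hq)
              have hq3 := (mem_filter.1 hq1).1
              simp only at hq2
              refine mem_coe.2 (mem_filter.2 ⟨(mem_product.1 (hR hq3)).2, ?_⟩)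
              rwa [← hq2]
            · intro q hq q' hq' h
              exact Prod.ext ((mem_filter.1 (mem_coe.1 hq)).2.trans
                (mem_filter.1 (mem_coe.1 hq')).2.symm) h
      _ = _ := by simp
  have hQc : #Q ≤ #R * (#R' * #B) := by
    rw [← card_product, ← card_product]
    refine card_le_card_of_injOn (fun t => (t.1, t.2.1, t.2.2.2)) ?_ ?_
    · intro t ht
      obtain ⟨ht1, ht2⟩ := mem_filter.1 (mem_coe.1 ht)
      obtain ⟨⟨m1, m2, m3⟩, -⟩ := mem_properTriples.1 ht1
      exact mem_coe.2 (mem_product.2 ⟨m1, mem_product.2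
        ⟨mem_filter.2 ⟨m2, ht2⟩, (mem_product.1 (hR m3)).2⟩⟩)
    · intro t ht t' ht' h
      simp only [Prod.mk.injEq] at h
      have ht1 := (mem_filter.1 (mem_coe.1 ht)).1
      refine properTriples_third_eq ht1 (mem_filter.1 (mem_coe.1 ht')).1 ?_ h.1 h.2.1 h.2.2
      intro h0
      exact hB (h0 ▸ (mem_product.1 (hR (mem_properTriples.1 ht1).1.2.2)).2)
  calc (#Q : ℝ) ≤ #R * (#R' * #B) := by exact_mod_cast hQc
    _ ≤ (#U * #B) * (#U * (ρ * #B) * #B) := by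
      gcongr
      exact_mod_cast hRc
    _ = _ := by ring

/-- Many proper triples force a large part of a horizontal line to be either small or contained in
an affine image of a small subfield. -/
theorem exists_row_subset {R : Finset (F × F)} {U B : Finset F} (hR : R ⊆ U ×ˢ B)
    (hB : (0 : F) ∉ B) {ρ : ℝ} (hρ : 0 < ρ)
    (hQ : 2 * (ρ * #U ^ 2 * #B ^ 3) ≤ #(properTriples R)) (hU : U.Nonempty) (hBne : B.Nonempty) :
    ρ ≤ 1 ∧ ∃ y ∈ B, ∃ Y : Finset F, (∀ w ∈ Y, (w, y) ∈ R) ∧ ρ ^ 5 / 96 * #B ≤ #Y ∧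
      ((#Y : ℝ) ^ 2 ≤ 8192 * (2 ^ 21 / ρ ^ 18) ^ 12 * #U ∨
        ∃ G : Subfield F, ∃ α β : F, (G : Set F).Finite ∧
          ↑Y ⊆ (fun g : F => α * g + β) '' (G : Set F) ∧ (G : Set F).ncard < #Y ^ 2) := by
  classical
  have ha : (0 : ℝ) < #U := by exact_mod_cast hU.card_pos
  have hb : (0 : ℝ) < #B := by exact_mod_cast hBne.card_pos
  have hB0 : ∀ y ∈ B, y ≠ 0 := fun y hy h => hB (h ▸ hy)
  set Q := (properTriples R).filter fun t => ρ * #B ≤ (columnDegree R B t.2.1.1 : ℝ) with hQdef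
  have hQc : ρ * #U ^ 2 * #B ^ 3 ≤ #Q := by
    have h1 := card_poor_triples_le hR hB hρ.le
    have h2 := card_filter_add_card_filter_not (s := properTriples R)
      (fun t => ρ * #B ≤ (columnDegree R B t.2.1.1 : ℝ))
    have h3 : (#Q : ℝ) + #((properTriples R).filter fun t =>
        ¬ ρ * #B ≤ (columnDegree R B t.2.1.1 : ℝ)) = #(properTriples R) := by
      exact_mod_cast h2
    linarith
  obtain ⟨⟨y₁, y₃⟩, hy, hfib⟩ := exists_le_card_fiber_of_nsmul_le_card_of_maps_to
    (s := Q) (t := B ×ˢ B) (f := fun t => (t.1.2, t.2.2.2)) (b := ρ * #U ^ 2 * #B) (by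
      intro t ht
      obtain ⟨⟨m1, m2, m3⟩, -⟩ := mem_properTriples.1 (mem_filter.1 ht).1
      exact mem_product.2 ⟨(mem_product.1 (hR m1)).2, (mem_product.1 (hR m3)).2⟩)
    (hBne.product hBne) (by
      rw [nsmul_eq_mul, card_product]
      push_cast
      refine le_trans (le_of_eq ?_) hQc
      ring)
  set S := Q.filter fun t => (t.1.2, t.2.2.2) = (y₁, y₃) with hS
  obtain ⟨hy₁, hy₃⟩ := mem_product.1 hy
  simp only at hy₁ hy₃
  have hy₁0 := hB0 _ hy₁
  have hy₃0 := hB0 _ hy₃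
  have hSmem : ∀ t ∈ S, t ∈ properTriples R ∧ ρ * #B ≤ (columnDegree R B t.2.1.1 : ℝ) ∧
      t.1.2 = y₁ ∧ t.2.2.2 = y₃ := by
    intro t ht
    obtain ⟨h1, h2⟩ := mem_filter.1 ht
    obtain ⟨h3, h4⟩ := mem_filter.1 h1
    simp only [Prod.mk.injEq] at h2
    exact ⟨h3, h4, h2⟩
  have hSne : S.Nonempty := by
    rw [← card_pos]
    have : (0 : ℝ) < ρ * #U ^ 2 * #B := by positivity
    exact_mod_cast this.trans_le hfib
  obtain ⟨t₀, ht₀⟩ := hSne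
  have hy₁₃ : y₁ ≠ y₃ := by
    obtain ⟨h1, -, h3, h4⟩ := hSmem t₀ ht₀
    rw [← h3, ← h4]
    exact (mem_properTriples.1 h1).2.2.1
  have hd : y₁⁻¹ - y₃⁻¹ ≠ 0 := sub_ne_zero.2 fun h => hy₁₃ (inv_injective h)
  -- Collinearity of the `(uᵢ, yᵢ⁻¹)` gives `(y₁⁻¹ - y₂⁻¹) u₃ = (y₃⁻¹ - y₂⁻¹) u₁ + (y₁⁻¹ - y₃⁻¹)
  -- u₂`; dividing by the last coefficient yields the relation with `x = ξ y₂`.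
  set ξ : F → F := fun y => (y₃⁻¹ - y⁻¹) / (y₁⁻¹ - y₃⁻¹) with hξ
  have hξinj : ξ.Injective := by
    intro y y' h
    have := (div_left_inj' hd).1 h
    exact inv_injective (sub_right_injective this)
  have hξ1 : ∀ y, 1 + ξ y = (y₁⁻¹ - y⁻¹) / (y₁⁻¹ - y₃⁻¹) := by
    intro y
    simp only [hξ]
    rw [eq_div_iff hd, add_mul, div_mul_cancel₀ _ hd]
    ring
  -- Removing `y₃` and `y₁` keeps `x` and `1 + x` nonzero.
  set B' := B.filter fun y => y ≠ y₁ ∧ y ≠ y₃ with hB'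
  set X := B'.image ξ with hX
  have hXc : #X = #B' := card_image_of_injective _ hξinj
  have hXB : #X ≤ #B := hXc ▸ card_filter_le _ _
  set H : F → F → F → Prop := fun x u w => (∃ s ∈ U, s ≠ u ∧ (1 + x) * s = x * u + w) ∧
    ρ * #B ≤ (columnDegree R B w : ℝ) with hH
  have hSmem' : ∀ t ∈ S, t.2.1.2 ∈ B' ∧ t.1.1 ∈ U ∧ t.2.1.1 ∈ U ∧ H (ξ t.2.1.2) t.1.1 t.2.1.1 := by
    rintro ⟨⟨u₁, z₁⟩, ⟨u₂, y₂⟩, ⟨u₃, z₃⟩⟩ ht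
    obtain ⟨h1, h2, h3, h4⟩ := hSmem _ ht
    obtain ⟨⟨m1, m2, m3⟩, n12, n13, n23, n, e⟩ := mem_properTriples.1 h1
    simp only at h2 h3 h4 m1 m2 m3 n12 n13 n23 n e
    subst h3 h4
    have hy₂ := (mem_product.1 (hR m2)).2
    have hy₂0 := hB0 _ hy₂
    refine ⟨mem_filter.2 ⟨hy₂, n12.symm, n23⟩, (mem_product.1 (hR m1)).1,
      (mem_product.1 (hR m2)).1, ⟨u₃, (mem_product.1 (hR m3)).1, n.symm, ?_⟩, h2⟩
    rw [hξ1]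
    simp only [hξ]
    rw [div_mul_eq_mul_div, div_mul_eq_mul_div, div_add' _ _ _ hd]
    congr 1
    simp only at hy₁0 hy₃0 hy₂0 ⊢
    field_simp
    linear_combination -e
  have hsum : (#S : ℝ) ≤ ∑ x ∈ X, ∑ u ∈ U, ∑ w ∈ U, if H x u w then (1 : ℝ) else 0 := by
    have h1 : #S ≤ #((X ×ˢ U ×ˢ U).filter fun t => H t.1 t.2.1 t.2.2) := by
      refine card_le_card_of_injOn (fun t => (ξ t.2.1.2, t.1.1, t.2.1.1)) ?_ ?_
      · intro t ht
        obtain ⟨h1, h2, h3, h4⟩ := hSmem' t (mem_coe.1 ht)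
        exact mem_coe.2 (mem_filter.2 ⟨mem_product.2 ⟨mem_image_of_mem _ h1,
          mem_product.2 ⟨h2, h3⟩⟩, h4⟩)
      · intro t ht t' ht' h
        simp only [Prod.mk.injEq] at h
        obtain ⟨h1, -, h3, h4⟩ := hSmem t (mem_coe.1 ht)
        obtain ⟨h1', -, h3', h4'⟩ := hSmem t' (mem_coe.1 ht')
        exact properTriples_third_eq h1 h1' (h4 ▸ hy₃0) (Prod.ext h.2.1 (h3.trans h3'.symm))
          (Prod.ext h.2.2 (hξinj h.1)) (h4.trans h4'.symm)
    refine le_trans (Nat.cast_le.2 h1) (le_of_eq ?_)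
    rw [card_filter, sum_product]
    push_cast
    exact sum_congr rfl fun x _ => by rw [sum_product]
  have hXne : X.Nonempty := ⟨_, mem_image_of_mem ξ (hSmem' t₀ ht₀).1⟩
  have hx : (0 : ℝ) < #X := by exact_mod_cast hXne.card_pos
  have hdens : ρ * #U ^ 2 * #X ≤ ∑ x ∈ X, ∑ u ∈ U, ∑ w ∈ U, if H x u w then (1 : ℝ) else 0 := by
    refine le_trans ?_ (hfib.trans hsum)
    gcongr
  have hρ1 : ρ ≤ 1 := by
    have h1 : ∑ x ∈ X, ∑ u ∈ U, ∑ w ∈ U, (if H x u w then (1 : ℝ) else 0) ≤ #U ^ 2 * #X := by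
      calc _ ≤ ∑ x ∈ X, ∑ u ∈ U, ∑ w ∈ U, (1 : ℝ) := by
            refine sum_le_sum fun _ _ => sum_le_sum fun _ _ => sum_le_sum fun _ _ => ?_
            split_ifs <;> norm_num
        _ = _ := by simp; ring
    have h2 : ρ * (#U ^ 2 * #X : ℝ) ≤ 1 * (#U ^ 2 * #X) := by
      rw [one_mul, ← mul_assoc]
      exact hdens.trans h1
    exact le_of_mul_le_mul_right h2 (by positivity)
  obtain ⟨v, hv, Y, -, hYE, hYc, hfin⟩ := exists_fiber_subset X U B H (fun u y => (u, y) ∈ R)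
    (ρ := ρ) hρ hρ1 (by
      intro x hx
      obtain ⟨y, hy, rfl⟩ := mem_image.1 hx
      obtain ⟨-, h1, h3⟩ := mem_filter.1 hy
      refine ⟨div_ne_zero (sub_ne_zero.2 fun h => h3 (inv_injective h).symm) hd, ?_⟩
      rw [hξ1]
      exact div_ne_zero (sub_ne_zero.2 fun h => h1 (inv_injective h).symm) hd)
    (fun x _ u _ w _ h => h.1) hdens (fun x _ u _ w _ h => h.2) hU hXne hBne
  refine ⟨hρ1, v, hv, Y, hYE, ?_, hfin⟩
  -- Two heights were removed and `X` is nonempty, so `|B| ≤ |X| + 2 ≤ 3|X|`; hence `96 = 3 · 32`.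
  have hB3 : (#B : ℝ) ≤ 3 * #X := by
    have h1 : B ⊆ B' ∪ {y₁, y₃} := by
      intro y hy
      by_cases h : y ≠ y₁ ∧ y ≠ y₃
      · exact mem_union_left _ (mem_filter.2 ⟨hy, h⟩)
      · refine mem_union_right _ ?_
        simp only [mem_insert, mem_singleton]
        tauto
    have h2 := (card_le_card h1).trans (card_union_le _ _)
    have h3 := card_le_two (a := y₁) (b := y₃)
    have h4 := hXne.card_pos
    have : #B ≤ 3 * #X := by omega
    exact_mod_cast this
  refine le_trans ?_ hYc
  calc ρ ^ 5 / 96 * #B ≤ ρ ^ 5 / 96 * (3 * #X) := by gcongr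
    _ = _ := by ring

end Selection

/-! ### The antifield hypothesis and the final numerology. -/

/-- In a `(2, lam)`-antifield, a subset of a row that is affinely contained in a small subfield has
at most `lam` elements. -/
theorem IsTwoAntifield.card_le {F : Type*} [Field F] {lam : ℝ} {P : Set (F × F)}
    (hP : IsTwoAntifield lam P) (hlam : 0 ≤ lam) {y : F} (hy : y ≠ 0) {Y : Finset F}
    (hY : ∀ w ∈ Y, (w * y, y) ∈ P) {G : Subfield F} {α β : F} (hG : (G : Set F).Finite)
    (hYG : ↑Y ⊆ (fun g : F => α * g + β) '' (G : Set F)) (hGY : (G : Set F).ncard < #Y ^ 2) :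
    (#Y : ℝ) ≤ lam := by
  -- Passing from `w` to the first coordinate `w y` dilates the affine copy of `G` by `y`.
  have h := hP G (α * y) (β * y)
  have h1 : (#Y : ℝ≥0∞) ≤ (({x : F | ∃ z : F, (x, z) ∈ P} ∩
      (fun g : F => α * y * g + β * y) '' (G : Set F)).encard : ℝ≥0∞) := by
    have h2 : (fun w => w * y) '' (Y : Set F) ⊆ {x : F | ∃ z : F, (x, z) ∈ P} ∩
        (fun g : F => α * y * g + β * y) '' (G : Set F) := by
      rintro _ ⟨w, hw, rfl⟩
      refine ⟨⟨y, hY w hw⟩, ?_⟩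
      obtain ⟨g, hg, rfl⟩ := hYG hw
      exact ⟨g, hg, by simp only; ring⟩
    have h3 := Set.encard_le_encard h2
    rw [(mul_left_injective₀ hy).encard_image, Set.encard_coe_eq_coe_finsetCard] at h3
    exact_mod_cast ENat.toENNReal_mono h3
  have h4 := h1.trans h
  rcases le_max_iff.1 h4 with h5 | h5
  · rw [← ENNReal.ofReal_natCast] at h5
    exact (ENNReal.ofReal_le_ofReal_iff hlam).1 h5
  · exfalso
    have h6 : ((G : Set F).encard : ℝ≥0∞) = (((G : Set F).ncard : ℕ) : ℝ≥0∞) := by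
      rw [← hG.cast_ncard_eq]
      simp
    rw [h6] at h5
    have h7 : (#Y : ℝ≥0∞) ^ (2 : ℝ) ≤ (((G : Set F).ncard : ℕ) : ℝ≥0∞) := by
      have := ENNReal.rpow_le_rpow h5 (show (0 : ℝ) ≤ 2 by norm_num)
      rwa [← ENNReal.rpow_mul, one_div, inv_mul_cancel₀ (by norm_num : (2 : ℝ) ≠ 0),
        ENNReal.rpow_one] at this
    rw [ENNReal.rpow_ofNat] at h7
    have h8 : #Y ^ 2 ≤ (G : Set F).ncard := by exact_mod_cast h7
    omega

/-- The degenerate contributions are dominated by the main term. -/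
theorem degenerate_le {a b m : ℝ} (ha : 1 ≤ a) (hb : 1 ≤ b) (hab : a ≤ b ^ 2) (hba : b ≤ a ^ 161)
    (hm : 0 ≤ m) (hm' : m ^ 321 = a ^ 643 * b ^ 961) :
    4 * (a * b) ^ 2 + b * a ^ 3 + a * b ^ 3 ≤ 6 * m := by
  have h1 : (a * b) ^ 2 ≤ m := by
    refine le_of_pow_le_pow_left₀ (n := 321) (by norm_num) hm ?_
    rw [hm']
    calc ((a * b) ^ 2) ^ 321 = a ^ 642 * b ^ 642 := by ring
      _ ≤ a ^ 643 * b ^ 961 := by gcongr <;> first | assumption | norm_num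
  -- In 321st powers this is exactly `a ≤ b²`, and the next bound is exactly `b ≤ a¹⁶¹`.
  have h2 : b * a ^ 3 ≤ m := by
    refine le_of_pow_le_pow_left₀ (n := 321) (by norm_num) hm ?_
    rw [hm']
    calc (b * a ^ 3) ^ 321 = a ^ 643 * b ^ 321 * a ^ 320 := by ring
      _ ≤ a ^ 643 * b ^ 321 * (b ^ 2) ^ 320 := by gcongr
      _ = a ^ 643 * b ^ 961 := by ring
  have h3 : a * b ^ 3 ≤ m := by
    refine le_of_pow_le_pow_left₀ (n := 321) (by norm_num) hm ?_
    rw [hm']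
    calc (a * b ^ 3) ^ 321 = a ^ 321 * b ^ 961 * b ^ 2 := by ring
      _ ≤ a ^ 321 * b ^ 961 * (a ^ 161) ^ 2 := by gcongr
      _ = a ^ 643 * b ^ 961 := by ring
  linarith

set_option exponentiation.threshold 1000 in
-- Combining the two bounds on `Y` gives `ρ²²⁶ b² ≤ 2²⁷⁹ a`, where `226 = 10 + 216`. As `ρ ≤ 1`, the
-- exponent may be raised to 321 to match `T³²¹`, and `2²⁷⁹ 4³²¹ ≤ 8³²¹`.
theorem pow_le_of_sq_le {a b ρ Y T : ℝ} (ha : 0 < a) (hb : 0 < b) (hρ : 0 < ρ) (hρ1 : ρ ≤ 1)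
    (hT : T = 4 * ρ * a ^ 2 * b ^ 3) (hY : ρ ^ 5 / 96 * b ≤ Y)
    (h : Y ^ 2 ≤ 8192 * (2 ^ 21 / ρ ^ 18) ^ 12 * a) : T ^ 321 ≤ 8 ^ 321 * (a ^ 643 * b ^ 961) := by
  have h1 : ρ ^ 226 * b ^ 2 ≤ 2 ^ 279 * a := by
    have h2 : (ρ ^ 5 / 96 * b) ^ 2 ≤ 8192 * (2 ^ 21 / ρ ^ 18) ^ 12 * a :=
      le_trans (by gcongr) h
    have h3 : 8192 * (2 ^ 21 / ρ ^ 18) ^ 12 * a = 2 ^ 265 * a / ρ ^ 216 := by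
      rw [div_pow, ← pow_mul, ← pow_mul]
      ring
    rw [h3, le_div_iff₀ (by positivity)] at h2
    have h4 : (ρ ^ 5 / 96 * b) ^ 2 * ρ ^ 216 = ρ ^ 226 * b ^ 2 / 9216 := by ring
    rw [h4, div_le_iff₀ (by norm_num)] at h2
    refine h2.trans ?_
    have : (9216 : ℝ) ≤ 2 ^ 14 := by norm_num
    calc 2 ^ 265 * a * 9216 ≤ 2 ^ 265 * a * 2 ^ 14 := by gcongr
      _ = _ := by ring
  have h5 : ρ ^ 321 * b ^ 2 ≤ 2 ^ 279 * a := by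
    refine le_trans ?_ h1
    gcongr ?_ * _
    exact pow_le_pow_of_le_one hρ.le hρ1 (by norm_num)
  calc T ^ 321 = 4 ^ 321 * a ^ 642 * b ^ 961 * (ρ ^ 321 * b ^ 2) := by rw [hT]; ring
    _ ≤ 4 ^ 321 * a ^ 642 * b ^ 961 * (2 ^ 279 * a) := by gcongr
    _ = 2 ^ 279 * 4 ^ 321 * (a ^ 643 * b ^ 961) := by ring
    _ ≤ 8 ^ 321 * (a ^ 643 * b ^ 961) := by
      gcongr ?_ * _
      norm_num

theorem exists_pos_eq_mul {a b T : ℝ} (hT : 0 < T) (ha : 0 < a) (hb : 0 < b) :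
    ∃ ρ : ℝ, 0 < ρ ∧ T = 4 * ρ * a ^ 2 * b ^ 3 :=
  ⟨T / (4 * a ^ 2 * b ^ 3), by positivity, by field_simp⟩

/-- The constant `γ₁` is chosen so that `λ = ρ⁶⁵ b / 97`, strictly below the lower bound `ρ⁵ b / 96`
for `|Y|` when `0 < ρ ≤ 1`. -/
theorem pow_div_eq_of_eq_mul {a b ρ T : ℝ} (ha : 0 < a) (hb : 0 < b)
    (hT : T = 4 * ρ * a ^ 2 * b ^ 3) :
    (97 * 4 ^ 65)⁻¹ * T ^ 65 / (a ^ 130 * b ^ 194) = ρ ^ 65 * b / 97 := by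
  rw [div_eq_iff (by positivity), hT, inv_mul_eq_iff_eq_mul₀ (by positivity)]
  ring

theorem antifieldConstant_nonneg (T a b : ℕ) :
    (0 : ℝ) ≤ (97 * 4 ^ 65)⁻¹ * (T : ℝ) ^ 65 / ((a : ℝ) ^ 130 * (b : ℝ) ^ 194) := by
  positivity

/-- The bound on collinear triples, with the main term `m` described by its power `m ^ 321`. -/
theorem card_le_of_collinearTuples {F : Type*} [Field F] {A B : Finset F} {P : Set (F × F)}
    (hB : (0 : F) ∉ B) (hP : ∀ p ∈ P, ∃ a ∈ A, ∃ b ∈ B, p ∈ originLine a ∧ p ∈ horizontalLine b)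
    (hA1 : A.Nonempty) (hB1 : B.Nonempty) {m : ℝ} (hm : 0 < m)
    (hm' : m ^ 321 = (#A : ℝ) ^ 643 * (#B : ℝ) ^ 961) (hAB : #A ≤ #B ^ 2) (hBA : #B ≤ #A ^ 161)
    (hanti : IsTwoAntifield ((97 * 4 ^ 65)⁻¹ *
      (collinearTuples 3 P (determinedLines P) : ℝ) ^ 65 / ((#A : ℝ) ^ 130 * (#B : ℝ) ^ 194)) P) :
    (collinearTuples 3 P (determinedLines P) : ℝ) ≤ 12 * m := by
  classical
  set T := collinearTuples 3 P (determinedLines P) with hT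
  by_contra! hcon
  have ha : (1 : ℝ) ≤ #A := by exact_mod_cast hA1.card_pos
  have hb : (1 : ℝ) ≤ #B := by exact_mod_cast hB1.card_pos
  set U := A.image fun a => a⁻¹ with hU
  have hUc : #U = #A := card_image_of_injective _ inv_injective
  have hPU : ∀ p ∈ P, p.1 / p.2 ∈ U ∧ p.2 ∈ B ∧ p.2 ≠ 0 := by
    intro p hp
    obtain ⟨a, ha, b, hb, h1, h2⟩ := hP p hp
    rw [mem_originLine] at h1
    rw [mem_horizontalLine] at h2
    have hb0 : p.2 ≠ 0 := fun h => hB (by rw [← h, h2]; exact hb)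
    refine ⟨mem_image.2 ⟨a, ha, ?_⟩, h2 ▸ hb, hb0⟩
    have hx : p.1 ≠ 0 := by
      intro h
      rw [h, mul_zero] at h1
      exact hb0 h1
    have ha0 : a ≠ 0 := by
      rintro rfl
      rw [zero_mul] at h1
      exact hb0 h1
    rw [h1]
    field_simp
  set R := (U ×ˢ B).filter fun q => (q.1 * q.2, q.2) ∈ P with hR
  have hRU : R ⊆ U ×ˢ B := filter_subset _ _
  have hPR : ∀ p ∈ P, (p.1 / p.2, p.2) ∈ R := by
    intro p hp
    obtain ⟨h1, h2, h3⟩ := hPU p hp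
    refine mem_filter.2 ⟨mem_product.2 ⟨h1, h2⟩, ?_⟩
    simp only [div_mul_cancel₀ _ h3]
    exact hp
  have hcount := collinearTuples_le hRU hB hPR
  rw [← hT, hUc] at hcount
  have hcount' : (T : ℝ) ≤ #(properTriples R) + 4 * (#A * #B) ^ 2 + #B * #A ^ 3 + #A * #B ^ 3 := by
    exact_mod_cast hcount
  have hdeg := degenerate_le ha hb (by exact_mod_cast hAB) (by exact_mod_cast hBA) hm.le hm'
  set a : ℝ := (#A : ℝ) with ha_def
  set b : ℝ := (#B : ℝ) with hb_def
  have ha0 : 0 < a := by linarith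
  have hb0 : 0 < b := by linarith
  have hTpos : (0 : ℝ) < T := by linarith
  -- Since `T > 12 m`, the degenerate triples, at most `6 m`, are fewer than `T / 2`. The factor 4
  -- leaves the required `2ρa²b³` proper triples.
  obtain ⟨ρ, hρ0, hTρ⟩ := exists_pos_eq_mul hTpos ha0 hb0
  obtain ⟨hρ1, y, hy, Y, hY, hYc, h⟩ := exists_row_subset hRU hB hρ0 (by
    rw [hUc, ← ha_def, ← hb_def]
    linarith) (hA1.image _) hB1
  rw [← hb_def] at hYc
  rcases h with h | ⟨G, α, β, hG, hYG, hGY⟩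
  · rw [hUc, ← ha_def] at h
    have h1 := pow_le_of_sq_le ha0 hb0 hρ0 hρ1 hTρ hYc h
    rw [← hm', ← mul_pow] at h1
    have h2 := le_of_pow_le_pow_left₀ (by norm_num) (mul_nonneg (by norm_num) hm.le) h1
    linarith
  · have h1 := hanti.card_le (antifieldConstant_nonneg _ _ _) (fun h0 => hB (h0 ▸ hy))
      (fun w hw => (mem_filter.1 (hY w hw)).2) hG hYG hGY
    rw [pow_div_eq_of_eq_mul ha0 hb0 hTρ] at h1
    have h3 : ρ ^ 65 ≤ ρ ^ 5 := pow_le_pow_of_le_one hρ0.le hρ1 (by norm_num)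
    have h4 : 0 < ρ ^ 5 * b := mul_pos (pow_pos hρ0 5) hb0
    have h5 : ρ ^ 65 * b ≤ ρ ^ 5 * b := mul_le_mul_of_nonneg_right h3 hb0.le
    linarith

end Antifield

theorem mainTheorem4 :
    ∃ γ₁ : ℝ, 0 < γ₁ ∧ ∃ C : ℝ, 0 < C ∧
      ∀ (F : Type*) [Field F] (A B : Finset F) (P : Set (F × F)) (T : ℕ),
        (0 : F) ∉ B →
        A.card ≤ B.card ^ 2 →
        B.card ≤ A.card ^ 161 →
        (∀ p ∈ P, ∃ a ∈ A, ∃ b ∈ B,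
          p ∈ Antifield.originLine a ∧ p ∈ Antifield.horizontalLine b) →
        T = Antifield.collinearTuples 3 P (Antifield.determinedLines P) →
        Antifield.IsTwoAntifield
          (γ₁ * (T : ℝ) ^ 65 / ((A.card : ℝ) ^ 130 * (B.card : ℝ) ^ 194)) P →
        (T : ℝ) ≤ C * max
          (max ((A.card : ℝ) ^ (643 / 321 : ℝ) * (B.card : ℝ) ^ (961 / 321 : ℝ))
            ((A.card : ℝ) ^ (535 / 267 : ℝ) * (B.card : ℝ) ^ (799 / 267 : ℝ)))
          ((A.card : ℝ) ^ (499 / 249 : ℝ) * (B.card : ℝ) ^ (743 / 249 : ℝ)) := by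
  refine ⟨(97 * 4 ^ 65)⁻¹, by positivity, 12, by norm_num, ?_⟩
  intro F _ A B P T hB hAB hBA hP hT hanti
  subst hT
  refine le_trans ?_ (mul_le_mul_of_nonneg_left ((le_max_left _ _).trans (le_max_left _ _))
    (by norm_num))
  by_cases hne : A.Nonempty ∧ B.Nonempty
  · obtain ⟨hA1, hB1⟩ := hne
    have ha : (0 : ℝ) < A.card := by exact_mod_cast hA1.card_pos
    have hb : (0 : ℝ) < B.card := by exact_mod_cast hB1.card_pos
    refine Antifield.card_le_of_collinearTuples hB hP hA1 hB1 (by positivity) ?_ hAB hBA hanti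
    rw [mul_pow, ← Real.rpow_mul_natCast ha.le, ← Real.rpow_mul_natCast hb.le,
      ← Real.rpow_natCast, ← Real.rpow_natCast]
    norm_num
  · have hPe : P = ∅ := by
      refine Set.eq_empty_of_forall_notMem fun p hp => hne ?_
      obtain ⟨a, ha, b, hb, -⟩ := hP p hp
      exact ⟨⟨a, ha⟩, ⟨b, hb⟩⟩
    have h0 : Antifield.collinearTuples 3 P (Antifield.determinedLines P) = 0 := by
      rw [Antifield.collinearTuples]
      have hem : {t : (Fin 3 → F × F) × AffineSubspace F (F × F) | (∀ i, t.1 i ∈ P) ∧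
          t.2 ∈ Antifield.determinedLines P ∧ ∀ i, t.1 i ∈ t.2} = ∅ := by
        refine Set.eq_empty_of_forall_notMem fun t ht => ?_
        have h0 := ht.1 0
        rw [hPe] at h0
        exact h0
      rw [hem, Set.ncard_empty]
    rw [h0, Nat.cast_zero]
    exact mul_nonneg (by norm_num) (mul_nonneg (Real.rpow_nonneg (Nat.cast_nonneg _) _)
      (Real.rpow_nonneg (Nat.cast_nonneg _) _))
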